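/- Units are such that $8\pi G=c=1$ (and $\Lambda=0$). Let $k\in\{0,1,-1\}$, let $I,J\subset\mathbb R$ be non-empty open intervals, and let $D\subset\mathbb R^2$ be a non-empty connected open set on which $1+\frac k4(x^2+y^2)\neq 0$. A *T-model* is a perfect fluid solution $G=(\rho+p)\,u\otimes u+p\,g$ of Einstein's equations on $\{t\in I,\ r\in J,\ (x,y)\in D\}$ with metric $$ds^2=-\frac{1}{v(t)}dt^2+\omega(t,r)^2dr^2+\varphi(t)\,C^2(dx^2+dy^2),\qquad C=\Big[1+\tfrac k4(x^2+y^2)\Big]^{-1},$$ with $v,\omega,\varphi>0$ smooth, and comoving unit velocity $u=\sqrt v\,\partial_t$. A dot denotes the derivative $\sqrt v\,\partial_t$ with respect to the proper time $\tau$ of the fluid, $u(f)$ is the derivative of $f$ along $u$, and $\theta=\nabla\cdot u$. A *thermodynamic scheme* is a set $\{n,\epsilon,s,\Theta\}$ of functions of the spacetime point, with $n,\epsilon,s$ of class $C^1$ and $n\ne0$, such that $u(n)+n\theta=0$, $\rho=n(1+\epsilon)$ and $\Theta\,ds=d\epsilon+p\,d(1/n)$. The fluid *evolves in local thermal equilibrium*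 if the conservation equations $dp+u(p)u+(\rho+p)\nabla_uu=0$, $u(\rho)+(\rho+p)\theta=0$ hold and a thermodynamic scheme exists. **Theorem.** (1) For every T-model, $u$ is geodesic, $\theta=\dot\varphi/\varphi+\dot\omega/\omega$, and $$p=\tfrac14\beta-\sigma-\xi,\qquad \rho=\tfrac14\beta+\xi+\frac{\dot\varphi}{\varphi}\frac{\dot\omega}{\omega},\qquad \sigma=\frac{\ddot\varphi}{\varphi},\quad \beta=\frac{\dot\varphi^2}{\varphi^2},\quad \xi=\frac k\varphi .$$ (2) Every T-model evolves in local thermal equilibrium. (3) For every T-model there are smooth functions $\omega_1,\omega_2$ of $t$ and $Q$, $a>0$ of $r$ such that $$\omega(t,r)=[\omega_1(t)+\omega_2(t)Q(r)]\,a(r),\qquad 2\varphi\,\ddot\omega_i+\dot\varphi\,\dot\omega_i-(\ddot\varphi+2k)\,\omega_i=0\quad(i=1,2)$$ ($a$ becomes $1$ after a change of the coordinate $r$). Now take any functions as in (3), and suppose that $\omega_1,\omega_2$ are linearly independent, that $Q'(r)\ne0$ on $J$, and that $\dot p\neq0$ and $\dot\varphi\ne0$ on $I$. Then: (4) The time $t$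 is a function of $p$, and $Q$ is the function of $(\rho,p)$ $$Q=-\frac{(\rho-p)\varphi\omega_1-(\dot\varphi\omega_1)^{\cdot}-2k\omega_1}{(\rho-p)\varphi\omega_2-(\dot\varphi\omega_2)^{\cdot}-2k\omega_2},$$ where the denominator does not vanish. (5) There are functions $\mathcal A,\mathcal B,\mathcal C$ of $p$, given along the evolution by $$\mathcal A=\mp\frac1{\sqrt\beta\,\dot p},\qquad \mathcal B=\mathcal A\,(p+q),\qquad \mathcal C=\mathcal A\,p\,q,\qquad q=\tfrac34\beta-\xi,$$ where $\pm$ is the sign of $\dot\varphi/\varphi$, such that $u(\rho)=u(p)\,[\mathcal A(p)\rho^2+\mathcal B(p)\rho+\mathcal C(p)]$. At every point with $u(\rho)\ne0$ the bracket is non-zero, and the square of the speed of sound is $$c_s^2=\Big(\frac{\partial p}{\partial\rho}\Big)_s=\frac{u(p)}{u(\rho)}=\chi(\rho,p)=\frac1{\mathcal A(p)\rho^2+\mathcal B(p)\rho+\mathcal C(p)},$$ the partial derivative being taken in any thermodynamic scheme. (6) The thermodynamic schemes are exactly the sets $\{n,\epsilon,s,\Theta\}$ of the form $$s=s(Q),\qquad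 n=\frac1{\varphi\,(\omega_1+\omega_2Q)\,N(Q)},\qquad \epsilon=\frac\rho n-1,\qquad \Theta=\ell(Q)\lambda_1(\tau)+m(Q)\lambda_2(\tau),$$ $$\lambda_i=\dot\varphi\,\dot\omega_i+\Big[\frac{\dot\varphi^2}{2\varphi}-\ddot\varphi\Big]\omega_i,\qquad \ell=\frac{N'}{s'},\qquad m=\frac{Q\,N'+N}{s'},$$ where $s$ and $N$ are arbitrary $C^1$ functions on the interval $Q(J)$ with $s'\neq0$ and $N\neq0$ everywhere. -/

import Mathlib

namespace TModel

/-! Differential geometry of a metric given by its components in a coordinate chart of `ℝ⁴`. -/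

/-- Coordinates `(t, r, x, y)` are the entries `0, 1, 2, 3`. -/
abbrev Pt : Type := Fin 4 → ℝ

/-- Partial derivative `∂_i f`. -/
noncomputable def pd (i : Fin 4) (f : Pt → ℝ) (x : Pt) : ℝ :=
  fderiv ℝ f x (Pi.single i 1)

/-- Christoffel symbols `Γ^i_{jl}` of the Levi-Civita connection. -/
noncomputable def christoffel (g : Pt → Matrix (Fin 4) (Fin 4) ℝ) (i j l : Fin 4) (x : Pt) : ℝ :=
  (1 / 2) * ∑ m, (g x)⁻¹ i m *
    (pd j (fun y => g y m l) x + pd l (fun y => g y m j) x - pd m (fun y => g y j l) x)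

/-- Ricci tensor
`R_{jl} = ∂_i Γ^i_{jl} - ∂_l Γ^i_{ji} + Γ^i_{im} Γ^m_{jl} - Γ^i_{lm} Γ^m_{ji}`. -/
noncomputable def ricci (g : Pt → Matrix (Fin 4) (Fin 4) ℝ) (j l : Fin 4) (x : Pt) : ℝ :=
  ∑ i, (pd i (christoffel g i j l) x - pd l (christoffel g i j i) x
    + ∑ m, (christoffel g i i m x * christoffel g m j l x
        - christoffel g i l m x * christoffel g m j i x))

/-- Scalar curvature. -/
noncomputable def scalarCurvature (g : Pt → Matrix (Fin 4) (Fin 4) ℝ) (x : Pt) : ℝ :=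
  ∑ j, ∑ l, (g x)⁻¹ j l * ricci g j l x

/-- Einstein tensor `G_{jl}`. -/
noncomputable def einstein (g : Pt → Matrix (Fin 4) (Fin 4) ℝ) (j l : Fin 4) (x : Pt) : ℝ :=
  ricci g j l x - (1 / 2) * scalarCurvature g x * g x j l

/-- The covariant components `u_i = g_{ij} u^j` of a vector field. -/
noncomputable def lower (g : Pt → Matrix (Fin 4) (Fin 4) ℝ) (u : Pt → Pt) (x : Pt) (i : Fin 4) :
    ℝ :=
  ∑ j, g x i j * u x j

/-- The derivative `u(q)` of a scalar along a vector field. -/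
noncomputable def along (u : Pt → Pt) (q : Pt → ℝ) (x : Pt) : ℝ :=
  fderiv ℝ q x (u x)

/-- The expansion `θ = ∇ · u`. -/
noncomputable def expansion (g : Pt → Matrix (Fin 4) (Fin 4) ℝ) (u : Pt → Pt) (x : Pt) : ℝ :=
  ∑ i, (pd i (fun y => u y i) x + ∑ j, christoffel g i i j x * u x j)

/-- The acceleration `a^i = u^j ∇_j u^i`. -/
noncomputable def acceleration (g : Pt → Matrix (Fin 4) (Fin 4) ℝ) (u : Pt → Pt) (x : Pt) : Pt :=
  fun i => ∑ j, u x j * (pd j (fun y => u y i) x + ∑ l, christoffel g i j l x * u x l)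

/-! Perfect fluids and local thermal equilibrium. -/

/-- On `U`, `u` is a unit timelike vector field and `G = (ρ + p) u ⊗ u + p g`
(units with `8πG = c = 1`). -/
def IsPerfectFluidSolution (U : Set Pt) (g : Pt → Matrix (Fin 4) (Fin 4) ℝ) (u : Pt → Pt)
    (ρ p : Pt → ℝ) : Prop :=
  ∀ x ∈ U, (∑ i, lower g u x i * u x i = -1) ∧
    ∀ i j, einstein g i j x = (ρ x + p x) * lower g u x i * lower g u x j + p x * g x i j

/-- The conservation equations `dp + u(p) u + (ρ + p) a = 0` and `u(ρ) + (ρ + p) θ = 0`. -/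
def IsPerfectEnergyTensor (U : Set Pt) (g : Pt → Matrix (Fin 4) (Fin 4) ℝ) (u : Pt → Pt)
    (ρ p : Pt → ℝ) : Prop :=
  ∀ x ∈ U,
    (∀ i, pd i p x + along u p x * lower g u x i
      + (ρ x + p x) * lower g (acceleration g u) x i = 0) ∧
    along u ρ x + (ρ x + p x) * expansion g u x = 0

/-- A thermodynamic scheme of the perfect energy tensor `(u, ρ, p)`: matter density `n`,
specific internal energy `ε`, specific entropy `s` and temperature `Θ`. -/
structure IsThermodynamicScheme (U : Set Pt) (g : Pt → Matrix (Fin 4) (Fin 4) ℝ) (u : Pt → Pt)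
    (ρ p : Pt → ℝ) (n ε s Θ : Pt → ℝ) : Prop where
  n_contDiff : ContDiffOn ℝ 1 n U
  ε_contDiff : ContDiffOn ℝ 1 ε U
  s_contDiff : ContDiffOn ℝ 1 s U
  n_ne_zero : ∀ x ∈ U, n x ≠ 0
  /-- `∇ · (n u) = u(n) + n θ = 0` -/
  matter_conservation : ∀ x ∈ U, along u n x + n x * expansion g u x = 0
  /-- `ρ = n (1 + ε)` -/
  energy_decomposition : ∀ x ∈ U, ρ x = n x * (1 + ε x)
  /-- `Θ ds = dε + p d(1/n)` -/
  first_law : ∀ x ∈ U,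
    Θ x • fderiv ℝ s x = fderiv ℝ ε x + p x • fderiv ℝ (fun y => 1 / n y) x

/-- The perfect energy tensor `(u, ρ, p)` evolves in local thermal equilibrium. -/
def EvolvesInLTE (U : Set Pt) (g : Pt → Matrix (Fin 4) (Fin 4) ℝ) (u : Pt → Pt)
    (ρ p : Pt → ℝ) : Prop :=
  IsPerfectEnergyTensor U g u ρ p ∧
    ∃ n ε s Θ : Pt → ℝ, IsThermodynamicScheme U g u ρ p n ε s Θ

/-- `(∂p/∂ρ)_s = c` at `x`: `dp = c dρ` on the directions along which `s` is constant, and `ρ` does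
vary along one of them. -/
def IsPartialAtConst (p ρ s : Pt → ℝ) (x : Pt) (c : ℝ) : Prop :=
  (∃ X : Pt, fderiv ℝ s x X = 0 ∧ fderiv ℝ ρ x X ≠ 0) ∧
    ∀ X : Pt, fderiv ℝ s x X = 0 → fderiv ℝ p x X = c * fderiv ℝ ρ x X

/-! T-models. -/

/-- The coordinate domain `t ∈ I`, `r ∈ J`, `(x, y) ∈ D`. -/
def domain (I J : Set ℝ) (D : Set (ℝ × ℝ)) : Set Pt :=
  {x | x 0 ∈ I ∧ x 1 ∈ J ∧ (x 2, x 3) ∈ D}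

/-- The metric `-(1/v(t)) dt² + ω(t,r)² dr² + φ(t) C² (dx² + dy²)`, where
`C = [1 + (k/4)(x² + y²)]⁻¹`. -/
noncomputable def metric (k : ℝ) (v φ : ℝ → ℝ) (ω : ℝ → ℝ → ℝ) (x : Pt) :
    Matrix (Fin 4) (Fin 4) ℝ :=
  Matrix.diagonal
    ![-(1 / v (x 0)), ω (x 0) (x 1) ^ 2,
      φ (x 0) * ((1 + k / 4 * (x 2 ^ 2 + x 3 ^ 2))⁻¹) ^ 2,
      φ (x 0) * ((1 + k / 4 * (x 2 ^ 2 + x 3 ^ 2))⁻¹) ^ 2]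

/-- The comoving unit velocity `u = √v ∂_t`. -/
noncomputable def velocity (v : ℝ → ℝ) (x : Pt) : Pt :=
  Pi.single 0 (√(v (x 0)))

/-- T-models: perfect fluid solutions with the metric above, in comoving coordinates. -/
structure IsTModel (k : ℝ) (I J : Set ℝ) (D : Set (ℝ × ℝ)) (v φ : ℝ → ℝ) (ω : ℝ → ℝ → ℝ)
    (ρ p : Pt → ℝ) : Prop where
  I_open : IsOpen I
  I_connected : IsConnected I
  J_open : IsOpen J
  J_connected : IsConnected J
  D_open : IsOpen D
  D_connected : IsConnected D
  chart : ∀ z ∈ D, 1 + k / 4 * (z.1 ^ 2 + z.2 ^ 2) ≠ 0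
  v_smooth : ContDiffOn ℝ (⊤ : ℕ∞) v I
  φ_smooth : ContDiffOn ℝ (⊤ : ℕ∞) φ I
  ω_smooth : ContDiffOn ℝ (⊤ : ℕ∞) (fun z : ℝ × ℝ => ω z.1 z.2) (I ×ˢ J)
  v_pos : ∀ t ∈ I, 0 < v t
  φ_pos : ∀ t ∈ I, 0 < φ t
  ω_pos : ∀ t ∈ I, ∀ r ∈ J, 0 < ω t r
  perfectFluid : IsPerfectFluidSolution (domain I J D) (metric k v φ ω) (velocity v) ρ p

/-- Derivative of a function of `t` with respect to the proper time `τ` of the fluid,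
`d/dτ = √v d/dt`. -/
noncomputable def dot (v f : ℝ → ℝ) (t : ℝ) : ℝ := √(v t) * deriv f t

noncomputable def σ (v φ : ℝ → ℝ) (t : ℝ) : ℝ := dot v (dot v φ) t / φ t

noncomputable def β (v φ : ℝ → ℝ) (t : ℝ) : ℝ := dot v φ t ^ 2 / φ t ^ 2

noncomputable def ξ (k : ℝ) (φ : ℝ → ℝ) (t : ℝ) : ℝ := k / φ t

/-- The pressure as a function of time, `β/4 - σ - ξ`. -/
noncomputable def pressure (k : ℝ) (v φ : ℝ → ℝ) (t : ℝ) : ℝ :=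
  1 / 4 * β v φ t - σ v φ t - ξ k φ t

/-- `q = (3/4) β - ξ`. -/
noncomputable def q (k : ℝ) (v φ : ℝ → ℝ) (t : ℝ) : ℝ := 3 / 4 * β v φ t - ξ k φ t

/-- `𝒜 = ∓ 1 / (√β ṗ)`, with `±` the sign of `φ̇ / φ`. -/
noncomputable def coeffA (k : ℝ) (v φ : ℝ → ℝ) (t : ℝ) : ℝ :=
  -Real.sign (dot v φ t / φ t) / (√(β v φ t) * dot v (pressure k v φ) t)

/-- `ℬ = 𝒜 (p + q)`. -/
noncomputable def coeffB (k : ℝ) (v φ : ℝ → ℝ) (t : ℝ) : ℝ :=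
  coeffA k v φ t * (pressure k v φ t + q k v φ t)

/-- `𝒞 = 𝒜 p q`. -/
noncomputable def coeffC (k : ℝ) (v φ : ℝ → ℝ) (t : ℝ) : ℝ :=
  coeffA k v φ t * pressure k v φ t * q k v φ t

/-- `w` solves `2 φ ẅ + φ̇ ẇ - (φ̈ + 2k) w = 0` on `I`. -/
def SolvesFieldEq (k : ℝ) (I : Set ℝ) (v φ w : ℝ → ℝ) : Prop :=
  ∀ t ∈ I, 2 * φ t * dot v (dot v w) t + dot v φ t * dot v w t
    - (dot v (dot v φ) t + 2 * k) * w t = 0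

/-- `ω(t,r) dr = (ω₁(t) + ω₂(t) Q(r)) a(r) dr` with `ω₁`, `ω₂` particular solutions of the field
equation; the positive factor `a` becomes `1` in the coordinate `r̃ = ∫ a dr`. -/
structure IsNormalForm (k : ℝ) (I J : Set ℝ) (v φ : ℝ → ℝ) (ω : ℝ → ℝ → ℝ)
    (ω₁ ω₂ a Q : ℝ → ℝ) : Prop where
  ω₁_smooth : ContDiffOn ℝ (⊤ : ℕ∞) ω₁ I
  ω₂_smooth : ContDiffOn ℝ (⊤ : ℕ∞) ω₂ I
  a_smooth : ContDiffOn ℝ (⊤ : ℕ∞) a J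
  Q_smooth : ContDiffOn ℝ (⊤ : ℕ∞) Q J
  a_pos : ∀ r ∈ J, 0 < a r
  ω_eq : ∀ t ∈ I, ∀ r ∈ J, ω t r = (ω₁ t + ω₂ t * Q r) * a r
  ω₁_solves : SolvesFieldEq k I v φ ω₁
  ω₂_solves : SolvesFieldEq k I v φ ω₂

/-- The standing assumptions `Q' ≠ 0`, `ṗ ≠ 0`, `φ̇ ≠ 0`, with `ω₁`, `ω₂` linearly independent. -/
structure IsRegular (k : ℝ) (I J : Set ℝ) (v φ : ℝ → ℝ) (ω₁ ω₂ Q : ℝ → ℝ) : Prop where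
  Q_ne : ∀ r ∈ J, deriv Q r ≠ 0
  p_ne : ∀ t ∈ I, dot v (pressure k v φ) t ≠ 0
  φ_ne : ∀ t ∈ I, dot v φ t ≠ 0
  independent : ∀ c₁ c₂ : ℝ, (∀ t ∈ I, c₁ * ω₁ t + c₂ * ω₂ t = 0) → c₁ = 0 ∧ c₂ = 0

/-- `λ_i = φ̇ ω̇_i + [φ̇²/(2φ) - φ̈] ω_i`. -/
noncomputable def lam (v φ w : ℝ → ℝ) (t : ℝ) : ℝ :=
  dot v φ t * dot v w t + (dot v φ t ^ 2 / (2 * φ t) - dot v (dot v φ) t) * w t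

/-- `(ρ - p) φ ω_i - (φ̇ ω_i)˙ - 2 k ω_i`, for given values of `ρ` and `p`. -/
noncomputable def stateTerm (k : ℝ) (v φ w : ℝ → ℝ) (t ρ p : ℝ) : ℝ :=
  (ρ - p) * φ t * w t - dot v (fun t' => dot v φ t' * w t') t - 2 * k * w t

end TModel

/-! For the T-model metric, Einstein's equations reduce to three scalar ones (`IsGeometry.fieldEq`).
The `11` component gives `p`, a function of time alone, the `00` component gives `ρ`, and isotropy
of the pressure is a second order linear equation in `t` for `ω(·, r)`, with coefficients
independent of `r`. Its solutions are determined by two initial data, so the functions `ω(·, r)`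
span at most a plane, whence the normal form (`IsTModel.exists_normalForm`).

The thermodynamics rests on one identity. With the comoving volume `V = φ (ω₁ + ω₂ Q)`, the enthalpy
is `(ρ + p) V = λ₁ + λ₂ Q`, and the field equation gives `λ̇ᵢ = ṗ φ ωᵢ` (`IsBackground.dot_lam`).
Hence `d((ρ + p) V) = V dp + λ₂ dQ`. Along `u` this is energy conservation, because `u(V) = V θ`. If
`1/n = V N`, it also gives `dε + p d(1/n) = (λ₁ + λ₂ Q) dN + N λ₂ dQ` (`IsTModel.laws`), which is a
multiple of `dQ` as soon as `N` depends on `Q` only. This produces the schemes.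

Conversely, matter conservation makes `N = 1/(nV)` independent of time. When `ṗ` and `φ̇` do not
vanish, `λ₁` and `λ₂` are linearly independent near every instant
(`IsBackground.eq_zero_of_lam_eventually`). Comparing their coefficients in the components of the
first law forces `s` and `N` to depend on `r` only (`IsTModel.scheme_radial`), and since `Q' ≠ 0`,
functions of `r` are functions of `Q`.

For the speed of sound, put `h = φ̇/φ`. The formula for `ρ` gives `θ = (ρ + q)/h`, so `u(ρ) = -(ρ +
p)(ρ + q)/h`, a quadratic in `ρ` whose coefficients depend on time, that is, on `p`. -/

namespace TModel

open Set Filter Topology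

/-! Calculus of the proper time derivative. -/

/-- An open interval of time with a smooth positive `v`, so that `√v ∂_t` is a smooth unit field. -/
structure IsClock (I : Set ℝ) (v : ℝ → ℝ) : Prop where
  isOpen : IsOpen I
  isPreconnected : IsPreconnected I
  smooth : ContDiffOn ℝ (⊤ : ℕ∞) v I
  pos : ∀ t ∈ I, 0 < v t

section Clock

variable {I : Set ℝ} {v : ℝ → ℝ}

lemma IsClock.sqrt_pos (h : IsClock I v) {t : ℝ} (ht : t ∈ I) : 0 < √(v t) :=
  Real.sqrt_pos.2 (h.pos t ht)

lemma IsClock.smooth_sqrt (h : IsClock I v) : ContDiffOn ℝ (⊤ : ℕ∞) (fun t => √(v t)) I :=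
  h.smooth.sqrt fun t ht => (h.pos t ht).ne'

lemma IsClock.smooth_dot (h : IsClock I v) {f : ℝ → ℝ} (hf : ContDiffOn ℝ (⊤ : ℕ∞) f I) :
    ContDiffOn ℝ (⊤ : ℕ∞) (dot v f) I :=
  h.smooth_sqrt.mul (hf.deriv_of_isOpen h.isOpen (by simp))

lemma hasDerivAt_of_smooth {I : Set ℝ} (hI : IsOpen I) {f : ℝ → ℝ} (hf : ContDiffOn ℝ (⊤ : ℕ∞) f I)
    {t : ℝ} (ht : t ∈ I) : HasDerivAt f (deriv f t) t :=
  ((hf.contDiffAt (hI.mem_nhds ht)).differentiableAt (by simp)).hasDerivAt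

/-- Writing coordinate derivatives as `d / √v` lets the usual differentiation rules be applied
directly to proper time derivatives; `IsClock.dot_eq_of_div` reads the result back. -/
lemma IsClock.hasDerivAt (h : IsClock I v) {f : ℝ → ℝ} (hf : ContDiffOn ℝ (⊤ : ℕ∞) f I)
    {t : ℝ} (ht : t ∈ I) : HasDerivAt f (dot v f t / √(v t)) t := by
  have := hasDerivAt_of_smooth h.isOpen hf ht
  rwa [dot, mul_div_cancel_left₀ _ (h.sqrt_pos ht).ne']

lemma dot_eq {f : ℝ → ℝ} {f' t : ℝ} (hf : HasDerivAt f f' t) : dot v f t = √(v t) * f' := by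
  rw [dot, hf.deriv]

lemma IsClock.dot_eq_of_div (h : IsClock I v) {f : ℝ → ℝ} {d t : ℝ} (ht : t ∈ I)
    (hf : HasDerivAt f (d / √(v t)) t) : dot v f t = d := by
  rw [dot_eq hf, mul_div_cancel₀ _ (h.sqrt_pos ht).ne']

lemma IsClock.dot_mul (h : IsClock I v) {f g : ℝ → ℝ} (hf : ContDiffOn ℝ (⊤ : ℕ∞) f I)
    (hg : ContDiffOn ℝ (⊤ : ℕ∞) g I) {t : ℝ} (ht : t ∈ I) :
    dot v (fun t => f t * g t) t = dot v f t * g t + f t * dot v g t := by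
  refine h.dot_eq_of_div ht (((h.hasDerivAt hf ht).mul (h.hasDerivAt hg ht)).congr_deriv ?_)
  ring

lemma IsClock.dot_lin (h : IsClock I v) {f g : ℝ → ℝ} (hf : ContDiffOn ℝ (⊤ : ℕ∞) f I)
    (hg : ContDiffOn ℝ (⊤ : ℕ∞) g I) (a b : ℝ) {t : ℝ} (ht : t ∈ I) :
    dot v (fun t => a * f t + b * g t) t = a * dot v f t + b * dot v g t := by
  refine h.dot_eq_of_div ht
    ((((h.hasDerivAt hf ht).const_mul a).add ((h.hasDerivAt hg ht).const_mul b)).congr_deriv ?_)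
  ring

lemma dot_congr (hI : IsOpen I) {f g : ℝ → ℝ} (hfg : EqOn f g I) : EqOn (dot v f) (dot v g) I :=
  fun t ht => by
    rw [dot, dot, (hfg.eventuallyEq_of_mem (hI.mem_nhds ht)).deriv_eq]

end Clock

/-! Second order linear equations. -/

/-- A compact interval inside `I` can be chosen with both instants in its interior. There the
operators `c t` are bounded, so the equation is uniformly Lipschitz and `f` agrees with the zero
solution. -/
lemma eq_zero_of_linear_ode {E : Type*} [NormedAddCommGroup E] [NormedSpace ℝ E] {I : Set ℝ}
    (hI : IsOpen I) (hI' : IsPreconnected I) {c : ℝ → E →L[ℝ] E} (hc : ContinuousOn c I)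
    {f : ℝ → E} (hf : ∀ t ∈ I, HasDerivAt f (c t (f t)) t) {t₀ : ℝ} (ht₀ : t₀ ∈ I)
    (h0 : f t₀ = 0) {t : ℝ} (ht : t ∈ I) : f t = 0 := by
  have hmin : min t₀ t ∈ I := by rcases min_choice t₀ t with h | h <;> rw [h] <;> assumption
  have hmax : max t₀ t ∈ I := by rcases max_choice t₀ t with h | h <;> rw [h] <;> assumption
  obtain ⟨a, ha, haI⟩ := exists_Icc_mem_subset_of_mem_nhds (hI.mem_nhds hmin) |>.imp
    fun a h => (show a < min t₀ t ∧ a ∈ I from by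
      obtain ⟨b, h1, h2, h3⟩ := h
      have := mem_of_mem_nhds h2
      rcases (Icc_mem_nhds_iff.1 h2) with ⟨h4, h5⟩
      exact ⟨h4, h3 ⟨le_rfl, h1.1.trans h1.2⟩⟩)
  obtain ⟨b, hb, hbI⟩ : ∃ b, max t₀ t < b ∧ b ∈ I := by
    obtain ⟨a, b, h1, h2, h3⟩ := exists_Icc_mem_subset_of_mem_nhds (hI.mem_nhds hmax)
    exact ⟨b, (Icc_mem_nhds_iff.1 h2).2, h3 ⟨h1.1.trans h1.2, le_rfl⟩⟩
  have hsub : Icc a b ⊆ I := hI'.ordConnected.out haI hbI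
  obtain ⟨K, hK⟩ := isCompact_Icc.exists_bound_of_continuousOn (hc.mono hsub)
  have hK' : ∀ s ∈ Ioo a b, LipschitzOnWith K.toNNReal (fun y => c s y) univ := fun s hs =>
    ((c s).lipschitz.weaken (by
      rw [← NNReal.coe_le_coe]
      exact (hK s (Ioo_subset_Icc_self hs)).trans (Real.le_coe_toNNReal K))).lipschitzOnWith
  exact ODE_solution_unique_of_mem_Ioo (v := fun s y => c s y) (s := fun _ => univ) (g := fun _ => 0)
    hK' ⟨ha.trans_le (min_le_left _ _), (le_max_left _ _).trans_lt hb⟩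
    (fun s hs => ⟨hf s (hsub (Ioo_subset_Icc_self hs)), mem_univ _⟩)
    (fun s _ => ⟨by simpa using hasDerivAt_const s (0 : E), mem_univ _⟩) h0
    ⟨ha.trans_le (min_le_right _ _), (le_max_right _ _).trans_lt hb⟩

/-- The data `(k, v, φ)` of a T-model that depend on time only. -/
structure IsBackground (I : Set ℝ) (v φ : ℝ → ℝ) : Prop extends IsClock I v where
  φ_smooth : ContDiffOn ℝ (⊤ : ℕ∞) φ I
  φ_pos : ∀ t ∈ I, 0 < φ t

/-! ### The field equation: Wronskians and the functions `λ_i`. -/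

section Background

variable {k : ℝ} {I : Set ℝ} {v φ w w₁ w₂ : ℝ → ℝ}

lemma IsBackground.eq_zero (h : IsBackground I v φ) (hw : ContDiffOn ℝ (⊤ : ℕ∞) w I)
    (hs : SolvesFieldEq k I v φ w) {t₀ : ℝ} (ht₀ : t₀ ∈ I) (h0 : w t₀ = 0) (h1 : dot v w t₀ = 0)
    {t : ℝ} (ht : t ∈ I) : w t = 0 := by
  have hv := h.smooth_sqrt.continuousOn
  have hv0 : ∀ t ∈ I, √(v t) ≠ 0 := fun t ht => (h.sqrt_pos ht).ne'
  have hφ := h.φ_smooth.continuousOn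
  have hφ1 := (h.smooth_dot h.φ_smooth).continuousOn
  have hφ2 := (h.smooth_dot (h.smooth_dot h.φ_smooth)).continuousOn
  have hφ0 : ∀ t ∈ I, 2 * φ t * √(v t) ≠ 0 := fun t ht =>
    mul_ne_zero (mul_ne_zero two_ne_zero (h.φ_pos t ht).ne') (hv0 t ht)
  let p₁ := ContinuousLinearMap.fst ℝ ℝ ℝ
  let p₂ := ContinuousLinearMap.snd ℝ ℝ ℝ
  -- The equation as a first order system for `(w, ẇ)`. The factors `1 / √v` convert proper time to
  -- the coordinate `t`.
  let c : ℝ → (ℝ × ℝ →L[ℝ] ℝ × ℝ) := fun t =>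
    (1 / √(v t)) • p₂.prod 0 + ((dot v (dot v φ) t + 2 * k) / (2 * φ t * √(v t))) • (0 : _ →L[ℝ] ℝ).prod p₁
      - (dot v φ t / (2 * φ t * √(v t))) • (0 : _ →L[ℝ] ℝ).prod p₂
  have hc : ContinuousOn c I := by
    have hd : ContinuousOn (fun t => 2 * φ t * √(v t)) I := (continuousOn_const.mul hφ).mul hv
    exact (((continuousOn_const.div hv hv0).smul continuousOn_const).add
      (((hφ2.add continuousOn_const).div hd hφ0).smul continuousOn_const)).sub
      ((hφ1.div hd hφ0).smul continuousOn_const)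
  have hf : ∀ t ∈ I, HasDerivAt (fun t => (w t, dot v w t)) (c t (w t, dot v w t)) t := by
    intro t ht
    refine ((h.hasDerivAt hw ht).prodMk (h.hasDerivAt (h.smooth_dot hw) ht)).congr_deriv ?_
    have := hs t ht
    have h1 := hv0 t ht
    have h2 := (h.φ_pos t ht).ne'
    ext
    · simp [c, p₁, p₂]; ring
    · simp [c, p₁, p₂]
      field_simp
      linear_combination this
  have := eq_zero_of_linear_ode h.isOpen h.isPreconnected hc hf ht₀ (by simp [h0, h1]) ht
  exact congrArg Prod.fst this

lemma SolvesFieldEq.lin (h : IsBackground I v φ) (hw₁ : ContDiffOn ℝ (⊤ : ℕ∞) w₁ I)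
    (hw₂ : ContDiffOn ℝ (⊤ : ℕ∞) w₂ I) (hs₁ : SolvesFieldEq k I v φ w₁) (hs₂ : SolvesFieldEq k I v φ w₂)
    (a b : ℝ) : SolvesFieldEq k I v φ (fun t => a * w₁ t + b * w₂ t) := by
  intro t ht
  have h1 : EqOn (dot v fun t => a * w₁ t + b * w₂ t) (fun t => a * dot v w₁ t + b * dot v w₂ t) I :=
    fun t ht => h.dot_lin hw₁ hw₂ a b ht
  rw [dot_congr h.isOpen h1 ht, h1 ht,
    h.dot_lin (h.smooth_dot hw₁) (h.smooth_dot hw₂) a b ht]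
  linear_combination a * hs₁ t ht + b * hs₂ t ht

/-- Two solutions with proportional initial data are linearly dependent. -/
lemma IsBackground.dependent (h : IsBackground I v φ) (hw₁ : ContDiffOn ℝ (⊤ : ℕ∞) w₁ I)
    (hw₂ : ContDiffOn ℝ (⊤ : ℕ∞) w₂ I) (hs₁ : SolvesFieldEq k I v φ w₁) (hs₂ : SolvesFieldEq k I v φ w₂)
    {t₀ : ℝ} (ht₀ : t₀ ∈ I) {a b : ℝ} (h0 : a * w₁ t₀ + b * w₂ t₀ = 0)
    (h1 : a * dot v w₁ t₀ + b * dot v w₂ t₀ = 0) {t : ℝ} (ht : t ∈ I) :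
    a * w₁ t + b * w₂ t = 0 :=
  h.eq_zero (w := fun t => a * w₁ t + b * w₂ t)
    ((contDiffOn_const.mul hw₁).add (contDiffOn_const.mul hw₂))
    (SolvesFieldEq.lin h hw₁ hw₂ hs₁ hs₂ a b) ht₀ h0 (by rw [h.dot_lin hw₁ hw₂ a b ht₀, h1]) ht

/-- A zero of the Wronskian at one instant yields a combination with vanishing initial data there,
hence a vanishing combination on all of `I`. -/
lemma IsBackground.wronskian_ne_zero (h : IsBackground I v φ) (hw₁ : ContDiffOn ℝ (⊤ : ℕ∞) w₁ I)
    (hw₂ : ContDiffOn ℝ (⊤ : ℕ∞) w₂ I) (hs₁ : SolvesFieldEq k I v φ w₁) (hs₂ : SolvesFieldEq k I v φ w₂)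
    (hind : ∀ c₁ c₂ : ℝ, (∀ t ∈ I, c₁ * w₁ t + c₂ * w₂ t = 0) → c₁ = 0 ∧ c₂ = 0)
    {t : ℝ} (ht : t ∈ I) : dot v w₁ t * w₂ t - w₁ t * dot v w₂ t ≠ 0 := by
  intro h0
  -- The combination with coefficients `(w₂ t, -w₁ t)` is trivial exactly when both values vanish;
  -- then the derivatives supply the coefficients instead.
  by_cases h2 : w₂ t = 0 ∧ w₁ t = 0
  · have := hind (dot v w₂ t) (-dot v w₁ t) fun s hs =>
      h.dependent hw₁ hw₂ hs₁ hs₂ ht (by rw [h2.1, h2.2]; ring) (by ring) hs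
    have h3 := hind 1 0 fun s hs => h.dependent hw₁ hw₂ hs₁ hs₂ ht (by rw [h2.2]; ring)
      (by have := neg_eq_zero.1 this.2; rw [this]; ring) hs
    exact one_ne_zero h3.1
  · have := hind (w₂ t) (-w₁ t) fun s hs =>
      h.dependent hw₁ hw₂ hs₁ hs₂ ht (by ring) (by linear_combination h0) hs
    exact h2 ⟨this.1, neg_eq_zero.1 this.2⟩

lemma IsBackground.pressure_smooth (h : IsBackground I v φ) :
    ContDiffOn ℝ (⊤ : ℕ∞) (pressure k v φ) I := by
  have h0 : ∀ t ∈ I, φ t ≠ 0 := fun t ht => (h.φ_pos t ht).ne'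
  have h1 := h.smooth_dot h.φ_smooth
  have h2 := h.smooth_dot h1
  exact ((contDiffOn_const.mul ((h1.pow 2).div (h.φ_smooth.pow 2) fun t ht => pow_ne_zero 2 (h0 t ht))).sub
    (h2.div h.φ_smooth h0)).sub (contDiffOn_const.div h.φ_smooth h0)

lemma IsBackground.dot_pressure (h : IsBackground I v φ) {t : ℝ} (ht : t ∈ I) :
    dot v (pressure k v φ) t = dot v φ t * dot v (dot v φ) t * (3 / 2) / φ t ^ 2
      - dot v φ t ^ 3 / (2 * φ t ^ 3) - dot v (dot v (dot v φ)) t / φ t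
      + k * dot v φ t / φ t ^ 2 := by
  have h0 := (h.φ_pos t ht).ne'
  have hv := (h.sqrt_pos ht).ne'
  have h1 := h.smooth_dot h.φ_smooth
  have e0 := h.hasDerivAt h.φ_smooth ht
  have e1 := h.hasDerivAt h1 ht
  have e2 := h.hasDerivAt (h.smooth_dot h1) ht
  refine h.dot_eq_of_div ht ((((((e1.pow 2).div (e0.pow 2) (pow_ne_zero 2 h0)).const_mul
    (1 / 4 : ℝ)).sub (e2.div e0 h0)).sub ((hasDerivAt_const t k).div e0 h0)).congr_deriv ?_)
  simp only [Pi.pow_apply]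
  field_simp
  ring

lemma IsBackground.lam_smooth (h : IsBackground I v φ) (hw : ContDiffOn ℝ (⊤ : ℕ∞) w I) :
    ContDiffOn ℝ (⊤ : ℕ∞) (lam v φ w) I := by
  have h1 := h.smooth_dot h.φ_smooth
  exact (h1.mul (h.smooth_dot hw)).add ((((h1.pow 2).div (contDiffOn_const.mul h.φ_smooth)
    fun t ht => mul_ne_zero two_ne_zero (h.φ_pos t ht).ne').sub (h.smooth_dot h1)).mul hw)

/-- The field equation multiplied by `φ̇/(2φ)` eliminates `ẅ`. The `ẇ` terms cancel, and the
remaining coefficient of `w` is exactly `φ ṗ`. -/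
lemma IsBackground.dot_lam (h : IsBackground I v φ) (hw : ContDiffOn ℝ (⊤ : ℕ∞) w I)
    (hs : SolvesFieldEq k I v φ w) {t : ℝ} (ht : t ∈ I) :
    dot v (lam v φ w) t = dot v (pressure k v φ) t * φ t * w t := by
  have h0 := (h.φ_pos t ht).ne'
  have hv := (h.sqrt_pos ht).ne'
  have h1 := h.smooth_dot h.φ_smooth
  have e0 := h.hasDerivAt h.φ_smooth ht
  have e1 := h.hasDerivAt h1 ht
  have e2 := h.hasDerivAt (h.smooth_dot h1) ht
  have f0 := h.hasDerivAt hw ht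
  have f1 := h.hasDerivAt (h.smooth_dot hw) ht
  rw [h.dot_pressure ht]
  refine h.dot_eq_of_div ht (((e1.mul f1).add ((((e1.pow 2).div (e0.const_mul 2)
    (mul_ne_zero two_ne_zero h0)).sub e2).mul f0)).congr_deriv ?_)
  have := hs t ht
  simp only [Pi.pow_apply, Pi.sub_apply, Pi.div_apply]
  field_simp
  linear_combination (φ t * dot v φ t) * this

/-- Differentiating the relation once gives `ṗ φ (A w₁ + B w₂) = 0`; inserting this into the
relation itself leaves `φ̇ (A ẇ₁ + B ẇ₂) = 0`. After division by `ṗ φ` and `φ̇`, the Wronskian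
decides. -/
lemma IsBackground.eq_zero_of_lam_eventually (h : IsBackground I v φ) (hw₁ : ContDiffOn ℝ (⊤ : ℕ∞) w₁ I)
    (hw₂ : ContDiffOn ℝ (⊤ : ℕ∞) w₂ I) (hs₁ : SolvesFieldEq k I v φ w₁) (hs₂ : SolvesFieldEq k I v φ w₂)
    {t : ℝ} (ht : t ∈ I) (hW : dot v w₁ t * w₂ t - w₁ t * dot v w₂ t ≠ 0)
    (hp : dot v (pressure k v φ) t ≠ 0) (hφ : dot v φ t ≠ 0) {A B : ℝ}
    (h0 : ∀ᶠ s in 𝓝 t, A * lam v φ w₁ s + B * lam v φ w₂ s = 0) : A = 0 ∧ B = 0 := by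
  have hφ0 := (h.φ_pos t ht).ne'
  have e0 := h0.self_of_nhds
  have e1 : A * dot v (lam v φ w₁) t + B * dot v (lam v φ w₂) t = 0 := by
    rw [← h.dot_lin (h.lam_smooth hw₁) (h.lam_smooth hw₂) A B ht, dot,
      Filter.EventuallyEq.deriv_eq (f := fun _ => (0 : ℝ)) h0]
    simp
  rw [h.dot_lam hw₁ hs₁ ht, h.dot_lam hw₂ hs₂ ht] at e1
  have e1' : A * w₁ t + B * w₂ t = 0 := by
    have : dot v (pressure k v φ) t * φ t * (A * w₁ t + B * w₂ t) = 0 := by linear_combination e1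
    exact (mul_eq_zero.1 this).resolve_left (mul_ne_zero hp hφ0)
  have e0' : A * dot v w₁ t + B * dot v w₂ t = 0 := by
    have : dot v φ t * (A * dot v w₁ t + B * dot v w₂ t) = 0 := by
      simp only [lam] at e0
      linear_combination e0 - (dot v φ t ^ 2 / (2 * φ t) - dot v (dot v φ) t) * e1'
    exact (mul_eq_zero.1 this).resolve_left hφ
  constructor
  · refine (mul_eq_zero.1 (?_ : A * (dot v w₁ t * w₂ t - w₁ t * dot v w₂ t) = 0)).resolve_right hW
    linear_combination w₂ t * e0' - dot v w₂ t * e1'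
  · refine (mul_eq_zero.1 (?_ : B * (dot v w₁ t * w₂ t - w₁ t * dot v w₂ t) = 0)).resolve_right hW
    linear_combination dot v w₁ t * e1' - w₁ t * e0'

end Background

end TModel

namespace TModel

open Set Filter Topology

/-! Coordinate derivatives. -/

lemma hasDerivAt_comp_update {f : Pt → ℝ} {x : Pt} (i : Fin 4) (hf : DifferentiableAt ℝ f x) :
    HasDerivAt (fun s => f (Function.update x i s)) (pd i f x) (x i) := by
  have h2 : HasFDerivAt f (fderiv ℝ f x) (Function.update x i (x i)) := by
    simpa using hf.hasFDerivAt
  exact h2.comp_hasDerivAt (x i) (hasDerivAt_update x i (x i))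

/-- Reduces a partial derivative to one-variable calculus, once joint differentiability is known. -/
lemma pd_eq_of_hasDerivAt {i : Fin 4} {f : Pt → ℝ} {x : Pt} {d : ℝ} (hf : DifferentiableAt ℝ f x)
    (h : HasDerivAt (fun s => f (Function.update x i s)) d (x i)) : pd i f x = d :=
  (hasDerivAt_comp_update i hf).unique h

lemma pd_congr {U : Set Pt} (hU : IsOpen U) {f g : Pt → ℝ} (hfg : EqOn f g U) (i : Fin 4) {x : Pt}
    (hx : x ∈ U) : pd i f x = pd i g x := by
  rw [pd, pd, (hfg.eventuallyEq_of_mem (hU.mem_nhds hx)).fderiv_eq]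

lemma inv_diagonal_of_ne_zero {d : Fin 4 → ℝ} (hd : ∀ i, d i ≠ 0) :
    (Matrix.diagonal d)⁻¹ = Matrix.diagonal (fun i => (d i)⁻¹) := by
  refine Matrix.inv_eq_right_inv ?_
  rw [Matrix.diagonal_mul_diagonal, ← Matrix.diagonal_one]
  congr 1
  funext i
  exact mul_inv_cancel₀ (hd i)

/-- Christoffel symbols of a diagonal metric. -/
lemma christoffel_diagonal {d : Pt → Fin 4 → ℝ} {x : Pt} (hd : ∀ i, d x i ≠ 0) (i j l : Fin 4) :
    christoffel (fun y => Matrix.diagonal (d y)) i j l x =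
      (2 * d x i)⁻¹ * ((if i = l then pd j (fun y => d y i) x else 0)
        + (if i = j then pd l (fun y => d y i) x else 0)
        - (if j = l then pd i (fun y => d y j) x else 0)) := by
  have hinv := inv_diagonal_of_ne_zero hd
  have hpd : ∀ a b c : Fin 4, pd a (fun y => Matrix.diagonal (d y) b c) x =
      if b = c then pd a (fun y => d y b) x else 0 := by
    intro a b c
    split_ifs with h
    · subst h; simp
    · simp [Matrix.diagonal_apply_ne _ h, pd]
  rw [christoffel, hinv, Finset.sum_eq_single i]
  · rw [Matrix.diagonal_apply_eq, hpd, hpd, hpd, mul_inv]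
    ring
  · intro m _ hm
    rw [Matrix.diagonal_apply_ne _ hm.symm, zero_mul]
  · simp

/-- The conformal factor `C`. -/
noncomputable def conf (k x y : ℝ) : ℝ := (1 + k / 4 * (x ^ 2 + y ^ 2))⁻¹

lemma hasDerivAt_conf_left {k x y : ℝ} (h : 1 + k / 4 * (x ^ 2 + y ^ 2) ≠ 0) :
    HasDerivAt (fun s => conf k s y) (-(k / 2) * x * conf k x y ^ 2) x := by
  have : HasDerivAt (fun s : ℝ => 1 + k / 4 * (s ^ 2 + y ^ 2)) (k / 4 * (2 * x)) x := by
    simpa using ((((hasDerivAt_pow 2 x).add_const (y ^ 2)).const_mul (k / 4)).const_add 1)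
  refine (this.inv h).congr_deriv ?_
  rw [conf]
  field_simp
  ring

lemma hasDerivAt_conf_right {k x y : ℝ} (h : 1 + k / 4 * (x ^ 2 + y ^ 2) ≠ 0) :
    HasDerivAt (fun s => conf k x s) (-(k / 2) * y * conf k x y ^ 2) y := by
  have := hasDerivAt_conf_left (k := k) (x := y) (y := x) (by rwa [add_comm (y ^ 2)])
  simpa only [conf, add_comm] using this

lemma differentiableAt_conf {k : ℝ} {x : Pt} (h : 1 + k / 4 * (x 2 ^ 2 + x 3 ^ 2) ≠ 0) :
    DifferentiableAt ℝ (fun x : Pt => conf k (x 2) (x 3)) x := by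
  unfold conf
  fun_prop (disch := assumption)

/-- The assumptions on the metric functions of a T-model, without the field equations. -/
structure IsGeometry (k : ℝ) (I J : Set ℝ) (D : Set (ℝ × ℝ)) (v φ : ℝ → ℝ) (ω : ℝ → ℝ → ℝ) :
    Prop extends IsBackground I v φ where
  J_open : IsOpen J
  D_open : IsOpen D
  chart : ∀ z ∈ D, 1 + k / 4 * (z.1 ^ 2 + z.2 ^ 2) ≠ 0
  ω_smooth : ContDiffOn ℝ (⊤ : ℕ∞) (fun z : ℝ × ℝ => ω z.1 z.2) (I ×ˢ J)
  ω_pos : ∀ t ∈ I, ∀ r ∈ J, 0 < ω t r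

/-- The Christoffel symbols of the metric of a T-model, `Γ^i_{jl}` being the entry
`i`, `j`, `l`. -/
noncomputable def gam (k : ℝ) (v φ : ℝ → ℝ) (ω : ℝ → ℝ → ℝ) (x : Pt) :
    Fin 4 → Fin 4 → Fin 4 → ℝ :=
  let a := -(deriv v (x 0) / (2 * v (x 0)))
  let b := v (x 0) * ω (x 0) (x 1) * deriv (fun t => ω t (x 1)) (x 0)
  let c := v (x 0) * deriv φ (x 0) / 2 * conf k (x 2) (x 3) ^ 2
  let d := deriv (fun t => ω t (x 1)) (x 0) / ω (x 0) (x 1)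
  let e := deriv (fun r => ω (x 0) r) (x 1) / ω (x 0) (x 1)
  let f := deriv φ (x 0) / (2 * φ (x 0))
  let m := -(k / 2) * x 2 * conf k (x 2) (x 3)
  let n := -(k / 2) * x 3 * conf k (x 2) (x 3)
  ![![![a, 0, 0, 0], ![0, b, 0, 0], ![0, 0, c, 0], ![0, 0, 0, c]],
    ![![0, d, 0, 0], ![d, e, 0, 0], ![0, 0, 0, 0], ![0, 0, 0, 0]],
    ![![0, 0, f, 0], ![0, 0, 0, 0], ![f, 0, m, n], ![0, 0, n, -m]],
    ![![0, 0, 0, f], ![0, 0, 0, 0], ![0, 0, -n, m], ![f, 0, m, n]]]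

lemma isOpen_domain {I J : Set ℝ} {D : Set (ℝ × ℝ)} (hI : IsOpen I) (hJ : IsOpen J)
    (hD : IsOpen D) : IsOpen (domain I J D) :=
  (hI.preimage (continuous_apply 0)).inter ((hJ.preimage (continuous_apply 1)).inter
    (hD.preimage ((continuous_apply 2).prodMk (continuous_apply 3))))

/-! ### Christoffel symbols of the T-model metric. -/

section Geometry

variable {k : ℝ} {I J : Set ℝ} {D : Set (ℝ × ℝ)} {v φ : ℝ → ℝ} {ω : ℝ → ℝ → ℝ}

lemma IsGeometry.isOpen_domain (h : IsGeometry k I J D v φ ω) : IsOpen (domain I J D) :=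
  TModel.isOpen_domain h.isOpen h.J_open h.D_open

lemma IsGeometry.smooth_left (h : IsGeometry k I J D v φ ω) {r : ℝ} (hr : r ∈ J) :
    ContDiffOn ℝ (⊤ : ℕ∞) (fun t => ω t r) I :=
  h.ω_smooth.comp (contDiffOn_id.prodMk contDiffOn_const) fun _ ht => ⟨ht, hr⟩

lemma IsGeometry.smooth_right (h : IsGeometry k I J D v φ ω) {t : ℝ} (ht : t ∈ I) :
    ContDiffOn ℝ (⊤ : ℕ∞) (fun r => ω t r) J :=
  h.ω_smooth.comp (contDiffOn_const.prodMk contDiffOn_id) fun _ hr => ⟨ht, hr⟩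

/-- The partial derivative is the full derivative of `ω` applied to `(1, 0)`, which is jointly
smooth. -/
lemma IsGeometry.smooth_deriv_left (h : IsGeometry k I J D v φ ω) :
    ContDiffOn ℝ (⊤ : ℕ∞) (fun z : ℝ × ℝ => deriv (fun t => ω t z.2) z.1) (I ×ˢ J) := by
  have ho := h.isOpen.prod h.J_open
  have h1 : ContDiffOn ℝ (⊤ : ℕ∞) (fun z => fderiv ℝ (fun z : ℝ × ℝ => ω z.1 z.2) z ((1 : ℝ), (0 : ℝ)))
      (I ×ˢ J) :=
    (h.ω_smooth.fderiv_of_isOpen ho (by simp)).clm_apply contDiffOn_const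
  refine h1.congr fun z hz => ?_
  have h2 := ((h.ω_smooth.contDiffAt (ho.mem_nhds hz)).differentiableAt (by simp)).hasFDerivAt
  exact (h2.comp_hasDerivAt z.1 ((hasDerivAt_id z.1).prodMk (hasDerivAt_const z.1 z.2))).deriv

lemma differentiableAt_time {f : ℝ → ℝ} (hI : IsOpen I) (hf : ContDiffOn ℝ (⊤ : ℕ∞) f I) {x : Pt}
    (hx : x 0 ∈ I) : DifferentiableAt ℝ (fun x : Pt => f (x 0)) x :=
  (hasDerivAt_of_smooth hI hf hx).differentiableAt.comp x (differentiableAt_apply 0 x)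

lemma differentiableAt_time_radius {F : ℝ × ℝ → ℝ} (hI : IsOpen I) (hJ : IsOpen J)
    (hF : ContDiffOn ℝ (⊤ : ℕ∞) F (I ×ˢ J)) {x : Pt} (hx : x 0 ∈ I) (hx' : x 1 ∈ J) :
    DifferentiableAt ℝ (fun x : Pt => F (x 0, x 1)) x :=
  DifferentiableAt.comp x (f := fun x : Pt => (x 0, x 1))
    ((hF.contDiffAt ((hI.prod hJ).mem_nhds ⟨hx, hx'⟩)).differentiableAt (by simp))
    ((differentiableAt_apply 0 x).prodMk (differentiableAt_apply 1 x))

/-- The diagonal entries of the metric. -/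
noncomputable def diagEntry (k : ℝ) (v φ : ℝ → ℝ) (ω : ℝ → ℝ → ℝ) (x : Pt) : Fin 4 → ℝ :=
  ![-(1 / v (x 0)), ω (x 0) (x 1) ^ 2, φ (x 0) * conf k (x 2) (x 3) ^ 2,
    φ (x 0) * conf k (x 2) (x 3) ^ 2]

lemma IsGeometry.conf_ne (h : IsGeometry k I J D v φ ω) {x : Pt} (hx : x ∈ domain I J D) :
    conf k (x 2) (x 3) ≠ 0 := inv_ne_zero (h.chart _ hx.2.2)

lemma IsGeometry.diagEntry_ne (h : IsGeometry k I J D v φ ω) {x : Pt} (hx : x ∈ domain I J D)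
    (i : Fin 4) : diagEntry k v φ ω x i ≠ 0 := by
  have h1 := (h.pos _ hx.1).ne'
  have h2 := (h.ω_pos _ hx.1 _ hx.2.1).ne'
  have h3 := (h.φ_pos _ hx.1).ne'
  have h4 := h.conf_ne hx
  fin_cases i <;> simp [diagEntry, h1, h2, h3, h4]

lemma IsGeometry.pd_diagEntry (h : IsGeometry k I J D v φ ω) {x : Pt} (hx : x ∈ domain I J D)
    (j i : Fin 4) : pd j (fun y => diagEntry k v φ ω y i) x =
      (![![deriv v (x 0) / v (x 0) ^ 2,
          2 * ω (x 0) (x 1) * deriv (fun t => ω t (x 1)) (x 0),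
          deriv φ (x 0) * conf k (x 2) (x 3) ^ 2, deriv φ (x 0) * conf k (x 2) (x 3) ^ 2],
        ![0, 2 * ω (x 0) (x 1) * deriv (fun r => ω (x 0) r) (x 1), 0, 0],
        ![0, 0, -(φ (x 0) * k * x 2 * conf k (x 2) (x 3) ^ 3),
          -(φ (x 0) * k * x 2 * conf k (x 2) (x 3) ^ 3)],
        ![0, 0, -(φ (x 0) * k * x 3 * conf k (x 2) (x 3) ^ 3),
          -(φ (x 0) * k * x 3 * conf k (x 2) (x 3) ^ 3)]] : Fin 4 → Fin 4 → ℝ) j i := by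
  have h1 := (h.pos _ hx.1).ne'
  have dv := differentiableAt_time h.isOpen h.smooth hx.1
  have dφ := differentiableAt_time h.isOpen h.φ_smooth hx.1
  have dω := differentiableAt_time_radius h.isOpen h.J_open h.ω_smooth hx.1 hx.2.1
  have dC := differentiableAt_conf (h.chart _ hx.2.2)
  have ev := hasDerivAt_of_smooth h.isOpen h.smooth hx.1
  have eφ := hasDerivAt_of_smooth h.isOpen h.φ_smooth hx.1
  have e0 := hasDerivAt_of_smooth h.isOpen (h.smooth_left hx.2.1) hx.1
  have e1 := hasDerivAt_of_smooth h.J_open (h.smooth_right hx.1) hx.2.1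
  have e2 := hasDerivAt_conf_left (h.chart _ hx.2.2)
  have e3 := hasDerivAt_conf_right (h.chart _ hx.2.2)
  refine pd_eq_of_hasDerivAt ?_ ?_
  · fin_cases i
    · simpa [diagEntry, one_div] using (dv.fun_inv h1).neg
    · exact dω.pow 2
    · exact dφ.mul (dC.pow 2)
    · exact dφ.mul (dC.pow 2)
  · have f0 : HasDerivAt (fun s => -(1 / v s)) (deriv v (x 0) / v (x 0) ^ 2) (x 0) := by
      refine (((hasDerivAt_const (x 0) (1 : ℝ)).div ev h1).neg).congr_deriv (by ring)
    have f1 := (e0.pow 2).congr_deriv (g' := 2 * ω (x 0) (x 1) * deriv (fun t => ω t (x 1)) (x 0))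
      (by norm_num)
    have f2 := (e1.pow 2).congr_deriv (g' := 2 * ω (x 0) (x 1) * deriv (fun r => ω (x 0) r) (x 1))
      (by norm_num)
    have f3 := eφ.mul_const (conf k (x 2) (x 3) ^ 2)
    have f4 := ((e2.pow 2).const_mul (φ (x 0))).congr_deriv
      (g' := -(φ (x 0) * k * x 2 * conf k (x 2) (x 3) ^ 3)) (by norm_num; ring)
    have f5 := ((e3.pow 2).const_mul (φ (x 0))).congr_deriv
      (g' := -(φ (x 0) * k * x 3 * conf k (x 2) (x 3) ^ 3)) (by norm_num; ring)
    fin_cases j <;> fin_cases i <;>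
      simp [diagEntry, Function.update] <;>
      first
        | exact hasDerivAt_const _ _
        | simpa using f0
        | exact f1
        | exact f2
        | exact f3
        | exact f4
        | exact f5

lemma IsGeometry.christoffel_eq (h : IsGeometry k I J D v φ ω) {x : Pt} (hx : x ∈ domain I J D)
    (i j l : Fin 4) : christoffel (metric k v φ ω) i j l x = gam k v φ ω x i j l := by
  have h1 := (h.pos _ hx.1).ne'
  have h2 := (h.ω_pos _ hx.1 _ hx.2.1).ne'
  have h3 := (h.φ_pos _ hx.1).ne'
  have h4 := h.conf_ne hx
  have key := christoffel_diagonal (d := diagEntry k v φ ω) (h.diagEntry_ne hx) i j l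
  simp only [h.pd_diagEntry hx] at key
  refine Eq.trans key ?_
  fin_cases i <;> fin_cases j <;> fin_cases l <;> simp [gam, diagEntry] <;> field_simp

end Geometry

end TModel

namespace TModel

open Set Filter Topology

/-! ### Ricci and Einstein tensors. -/

section Curvature

variable {k : ℝ} {I J : Set ℝ} {D : Set (ℝ × ℝ)} {v φ : ℝ → ℝ} {ω : ℝ → ℝ → ℝ}

lemma IsClock.dot_dot (h : IsClock I v) {f : ℝ → ℝ} (hf : ContDiffOn ℝ (⊤ : ℕ∞) f I) {t : ℝ}
    (ht : t ∈ I) : dot v (dot v f) t = v t * deriv (deriv f) t + deriv v t / 2 * deriv f t := by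
  have hv := (h.sqrt_pos ht).ne'
  have hf' : ContDiffOn ℝ (⊤ : ℕ∞) (deriv f) I := hf.deriv_of_isOpen h.isOpen (by simp)
  have e := (((hasDerivAt_of_smooth h.isOpen h.smooth ht).sqrt (h.pos t ht).ne').mul
    (hasDerivAt_of_smooth h.isOpen hf' ht))
  rw [dot_eq (f := dot v f) e]
  have h2 : √(v t) ^ 2 = v t := Real.sq_sqrt (h.pos t ht).le
  field_simp
  linear_combination (2 * deriv (deriv f) t) * h2

lemma IsGeometry.pd_christoffel (h : IsGeometry k I J D v φ ω) {x : Pt} (hx : x ∈ domain I J D)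
    (a i j l : Fin 4) :
    pd a (christoffel (metric k v φ ω) i j l) x = pd a (fun y => gam k v φ ω y i j l) x :=
  pd_congr h.isOpen_domain (fun _ hy => h.christoffel_eq hy i j l) a hx

/-- Up to repetitions, these are the nonzero derivatives that survive in the diagonal Ricci
components. Terms such as `∂_t Γ⁰₀₀` and `∂_r Γ¹₁₁` cancel there, so no derivative of them is
computed. -/
lemma IsGeometry.pd_gam (h : IsGeometry k I J D v φ ω) {x : Pt} (hx : x ∈ domain I J D) :
    pd 0 (fun y => gam k v φ ω y 0 1 1) x =
        deriv v (x 0) * ω (x 0) (x 1) * deriv (fun t => ω t (x 1)) (x 0)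
        + v (x 0) * deriv (fun t => ω t (x 1)) (x 0) ^ 2
        + v (x 0) * ω (x 0) (x 1) * deriv (deriv (fun t => ω t (x 1))) (x 0) ∧
      pd 0 (fun y => gam k v φ ω y 0 2 2) x =
        (deriv v (x 0) * deriv φ (x 0) + v (x 0) * deriv (deriv φ) (x 0)) / 2
          * conf k (x 2) (x 3) ^ 2 ∧
      pd 0 (fun y => gam k v φ ω y 1 0 1) x =
        deriv (deriv (fun t => ω t (x 1))) (x 0) / ω (x 0) (x 1)
          - deriv (fun t => ω t (x 1)) (x 0) ^ 2 / ω (x 0) (x 1) ^ 2 ∧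
      pd 0 (fun y => gam k v φ ω y 2 0 2) x =
        deriv (deriv φ) (x 0) / (2 * φ (x 0)) - deriv φ (x 0) ^ 2 / (2 * φ (x 0) ^ 2) ∧
      pd 2 (fun y => gam k v φ ω y 2 2 2) x =
        -(k / 2) * conf k (x 2) (x 3) + k ^ 2 / 4 * x 2 ^ 2 * conf k (x 2) (x 3) ^ 2 ∧
      pd 3 (fun y => gam k v φ ω y 2 2 3) x =
        -(k / 2) * conf k (x 2) (x 3) + k ^ 2 / 4 * x 3 ^ 2 * conf k (x 2) (x 3) ^ 2 ∧
      pd 2 (fun y => gam k v φ ω y 2 3 3) x =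
        k / 2 * conf k (x 2) (x 3) - k ^ 2 / 4 * x 2 ^ 2 * conf k (x 2) (x 3) ^ 2 ∧
      pd 3 (fun y => gam k v φ ω y 3 2 2) x =
        k / 2 * conf k (x 2) (x 3) - k ^ 2 / 4 * x 3 ^ 2 * conf k (x 2) (x 3) ^ 2 := by
  have h1 := (h.pos _ hx.1).ne'
  have h2 := (h.ω_pos _ hx.1 _ hx.2.1).ne'
  have h3 := (h.φ_pos _ hx.1).ne'
  have sφ : ContDiffOn ℝ (⊤ : ℕ∞) (deriv φ) I := h.φ_smooth.deriv_of_isOpen h.isOpen (by simp)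
  have dv := differentiableAt_time h.isOpen h.smooth hx.1
  have dφ := differentiableAt_time h.isOpen h.φ_smooth hx.1
  have dφ' := differentiableAt_time h.isOpen sφ hx.1
  have dω := differentiableAt_time_radius h.isOpen h.J_open h.ω_smooth hx.1 hx.2.1
  have dω' := differentiableAt_time_radius h.isOpen h.J_open h.smooth_deriv_left hx.1 hx.2.1
  have dC := differentiableAt_conf (h.chart _ hx.2.2)
  have ev := hasDerivAt_of_smooth h.isOpen h.smooth hx.1
  have eφ := hasDerivAt_of_smooth h.isOpen h.φ_smooth hx.1
  have eφ' := hasDerivAt_of_smooth h.isOpen sφ hx.1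
  have e0 := hasDerivAt_of_smooth h.isOpen (h.smooth_left hx.2.1) hx.1
  have e0' := hasDerivAt_of_smooth h.isOpen
    ((h.smooth_left hx.2.1).deriv_of_isOpen h.isOpen (m := (⊤ : ℕ∞)) (by simp)) hx.1
  have e2 := hasDerivAt_conf_left (h.chart _ hx.2.2)
  have e3 := hasDerivAt_conf_right (h.chart _ hx.2.2)
  have dx : ∀ i, DifferentiableAt ℝ (fun x : Pt => x i) x := fun i => differentiableAt_apply i x
  have f2 := ((hasDerivAt_id (x 2)).const_mul (-(k / 2))).mul e2
  have f3 := ((hasDerivAt_id (x 3)).const_mul (-(k / 2))).mul e3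
  have d2 := ((dx 2).const_mul (-(k / 2))).mul dC
  have d3 := ((dx 3).const_mul (-(k / 2))).mul dC
  refine ⟨?_, ?_, ?_, ?_, ?_, ?_, ?_, ?_⟩
  · refine pd_eq_of_hasDerivAt ((dv.mul dω).mul dω') ?_
    change HasDerivAt (fun s => v s * ω s (x 1) * deriv (fun t => ω t (x 1)) s) _ (x 0)
    exact ((ev.mul e0).mul e0').congr_deriv (by simp only [Pi.mul_apply]; ring)
  · have d := ((dv.fun_mul dφ').fun_mul (differentiableAt_const (2 : ℝ)⁻¹)).fun_mul (dC.fun_pow 2)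
    simp only [← div_eq_mul_inv] at d
    refine pd_eq_of_hasDerivAt d ?_
    change HasDerivAt (fun s => v s * deriv φ s / 2 * conf k (x 2) (x 3) ^ 2) _ (x 0)
    exact ((ev.mul eφ').div_const 2).mul_const _
  · refine pd_eq_of_hasDerivAt (f := fun y => gam k v φ ω y 1 0 1)
      (by simpa [gam, div_eq_mul_inv] using dω'.fun_mul (dω.fun_inv h2)) ?_
    change HasDerivAt (fun s => deriv (fun t => ω t (x 1)) s / ω s (x 1)) _ (x 0)
    exact (e0'.div e0 h2).congr_deriv (by field_simp)
  · refine pd_eq_of_hasDerivAt (f := fun y => gam k v φ ω y 2 0 2)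
      (by simpa [gam, div_eq_mul_inv] using
        dφ'.fun_mul ((dφ.const_mul 2).fun_inv (mul_ne_zero two_ne_zero h3))) ?_
    change HasDerivAt (fun s => deriv φ s / (2 * φ s)) _ (x 0)
    exact (eφ'.div (eφ.const_mul 2) (mul_ne_zero two_ne_zero h3)).congr_deriv (by field_simp)
  · refine pd_eq_of_hasDerivAt d2 ?_
    change HasDerivAt (fun s => -(k / 2) * s * conf k s (x 3)) _ (x 2)
    exact f2.congr_deriv (by simp only [id]; ring)
  · refine pd_eq_of_hasDerivAt d3 ?_
    change HasDerivAt (fun s => -(k / 2) * s * conf k (x 2) s) _ (x 3)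
    exact f3.congr_deriv (by simp only [id]; ring)
  · refine pd_eq_of_hasDerivAt d2.neg ?_
    change HasDerivAt (fun s => -(-(k / 2) * s * conf k s (x 3))) _ (x 2)
    exact f2.neg.congr_deriv (by simp only [id]; ring)
  · refine pd_eq_of_hasDerivAt d3.neg ?_
    change HasDerivAt (fun s => -(-(k / 2) * s * conf k (x 2) s)) _ (x 3)
    exact f3.neg.congr_deriv (by simp only [id]; ring)

lemma pd_const (i : Fin 4) (c : ℝ) (x : Pt) : pd i (fun _ => c) x = 0 := by simp [pd]

lemma IsGeometry.conf_eq (h : IsGeometry k I J D v φ ω) {x : Pt} (hx : x ∈ domain I J D) :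
    conf k (x 2) (x 3) * (1 + k / 4 * (x 2 ^ 2 + x 3 ^ 2)) = 1 :=
  inv_mul_cancel₀ (h.chart _ hx.2.2)

lemma IsGeometry.ricci_diag (h : IsGeometry k I J D v φ ω) {x : Pt} (hx : x ∈ domain I J D) :
    ricci (metric k v φ ω) 0 0 x = -(1 / v (x 0)) *
        (dot v (dot v (fun t => ω t (x 1))) (x 0) / ω (x 0) (x 1) + σ v φ (x 0)
          - 1 / 2 * β v φ (x 0)) ∧
      ricci (metric k v φ ω) 1 1 x = ω (x 0) (x 1) ^ 2 *
        (dot v (dot v (fun t => ω t (x 1))) (x 0) / ω (x 0) (x 1)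
          + dot v φ (x 0) / φ (x 0) * (dot v (fun t => ω t (x 1)) (x 0) / ω (x 0) (x 1))) ∧
      ricci (metric k v φ ω) 2 2 x = φ (x 0) * conf k (x 2) (x 3) ^ 2 *
        (1 / 2 * σ v φ (x 0) + ξ k φ (x 0)
          + 1 / 2 * (dot v φ (x 0) / φ (x 0) * (dot v (fun t => ω t (x 1)) (x 0) / ω (x 0) (x 1)))) ∧
      ricci (metric k v φ ω) 3 3 x = φ (x 0) * conf k (x 2) (x 3) ^ 2 *
        (1 / 2 * σ v φ (x 0) + ξ k φ (x 0)
          + 1 / 2 * (dot v φ (x 0) / φ (x 0) * (dot v (fun t => ω t (x 1)) (x 0) / ω (x 0) (x 1)))) := by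
  have h1 := (h.pos _ hx.1).ne'
  have h2 := (h.ω_pos _ hx.1 _ hx.2.1).ne'
  have h3 := (h.φ_pos _ hx.1).ne'
  have hC := h.conf_eq hx
  have hd1 := h.dot_dot h.φ_smooth hx.1
  have hd2 := h.dot_dot (h.smooth_left hx.2.1) hx.1
  have hs : √(v (x 0)) ^ 2 = v (x 0) := Real.sq_sqrt (h.pos _ hx.1).le
  obtain ⟨p1, p2, p3, p4, p5, p6, p7, p8⟩ := h.pd_gam hx
  have p4' : pd 0 (fun y => gam k v φ ω y 3 0 3) x = pd 0 (fun y => gam k v φ ω y 2 0 2) x := rfl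
  have p2' : pd 0 (fun y => gam k v φ ω y 0 3 3) x = pd 0 (fun y => gam k v φ ω y 0 2 2) x := rfl
  have p5' : pd 2 (fun y => gam k v φ ω y 3 2 3) x = pd 2 (fun y => gam k v φ ω y 2 2 2) x := rfl
  have p6' : pd 3 (fun y => gam k v φ ω y 2 3 2) x = pd 3 (fun y => gam k v φ ω y 2 2 3) x := rfl
  have z1 : pd 1 (fun y => gam k v φ ω y 1 0 0) x = 0 := pd_const _ _ _
  have z2 : pd 2 (fun y => gam k v φ ω y 2 0 0) x = 0 := pd_const _ _ _
  have z3 : pd 3 (fun y => gam k v φ ω y 3 0 0) x = 0 := pd_const _ _ _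
  have z4 : pd 2 (fun y => gam k v φ ω y 2 1 1) x = 0 := pd_const _ _ _
  have z5 : pd 3 (fun y => gam k v φ ω y 3 1 1) x = 0 := pd_const _ _ _
  have z6 : pd 1 (fun y => gam k v φ ω y 0 1 0) x = 0 := pd_const _ _ _
  have z7 : pd 1 (fun y => gam k v φ ω y 2 1 2) x = 0 := pd_const _ _ _
  have z8 : pd 1 (fun y => gam k v φ ω y 3 1 3) x = 0 := pd_const _ _ _
  have z9 : pd 1 (fun y => gam k v φ ω y 1 2 2) x = 0 := pd_const _ _ _
  have z10 : pd 2 (fun y => gam k v φ ω y 0 2 0) x = 0 := pd_const _ _ _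
  have z11 : pd 2 (fun y => gam k v φ ω y 1 2 1) x = 0 := pd_const _ _ _
  have z12 : pd 1 (fun y => gam k v φ ω y 1 3 3) x = 0 := pd_const _ _ _
  have z13 : pd 3 (fun y => gam k v φ ω y 0 3 0) x = 0 := pd_const _ _ _
  have z14 : pd 3 (fun y => gam k v φ ω y 1 3 1) x = 0 := pd_const _ _ _
  simp only [ricci, h.pd_christoffel hx, h.christoffel_eq hx, Fin.sum_univ_four]
  simp only [p4', p2', p5', p6', z1, z2, z3, z4, z5, z6, z7, z8, z9, z10, z11, z12, z13, z14,
    p1, p2, p3, p4, p5, p6, p7, p8]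
  simp only [σ, β, ξ, hd1, hd2]
  simp only [dot]
  rw [mul_pow, hs]
  have hs' : √(v (x 0)) * deriv φ (x 0) / φ (x 0)
      * (√(v (x 0)) * deriv (fun t => ω t (x 1)) (x 0) / ω (x 0) (x 1))
      = v (x 0) * (deriv φ (x 0) / φ (x 0)) * (deriv (fun t => ω t (x 1)) (x 0) / ω (x 0) (x 1)) := by
    linear_combination (deriv φ (x 0) / φ (x 0) * (deriv (fun t => ω t (x 1)) (x 0) / ω (x 0) (x 1))) * hs
  rw [hs']
  -- From here the conformal factor enters only through `C (1 + k (x² + y²)/4) = 1`, which turns the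
  -- curvature of the `(x, y)` surfaces into the constant `k`.
  refine ⟨?_, ?_, ?_, ?_⟩ <;> simp [gam] <;> generalize conf k (x 2) (x 3) = c at hC ⊢ <;> field_simp
  · ring
  · ring
  · linear_combination (-16 * φ (x 0) * ω (x 0) (x 1) * k * c) * hC
  · linear_combination (-16 * φ (x 0) * ω (x 0) (x 1) * k * c) * hC

/-- The diagonal components of the Einstein tensor of the metric of a T-model. -/
lemma IsGeometry.einstein_diag (h : IsGeometry k I J D v φ ω) {x : Pt} (hx : x ∈ domain I J D) :
    einstein (metric k v φ ω) 0 0 x = 1 / v (x 0) *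
        (1 / 4 * β v φ (x 0) + ξ k φ (x 0)
          + dot v φ (x 0) / φ (x 0) * (dot v (fun t => ω t (x 1)) (x 0) / ω (x 0) (x 1))) ∧
      einstein (metric k v φ ω) 1 1 x = ω (x 0) (x 1) ^ 2 * pressure k v φ (x 0) ∧
      einstein (metric k v φ ω) 2 2 x = φ (x 0) * conf k (x 2) (x 3) ^ 2 *
        -(1 / 2 * σ v φ (x 0) - 1 / 4 * β v φ (x 0)
          + dot v (dot v (fun t => ω t (x 1))) (x 0) / ω (x 0) (x 1)
          + 1 / 2 * (dot v φ (x 0) / φ (x 0)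
            * (dot v (fun t => ω t (x 1)) (x 0) / ω (x 0) (x 1)))) := by
  obtain ⟨r0, r1, r2, r3⟩ := h.ricci_diag hx
  have h1 := (h.pos _ hx.1).ne'
  have h2 := (h.ω_pos _ hx.1 _ hx.2.1).ne'
  have h3 := (h.φ_pos _ hx.1).ne'
  have h4 := h.conf_ne hx
  have hg : metric k v φ ω x = Matrix.diagonal (diagEntry k v φ ω x) := rfl
  have hinv : (metric k v φ ω x)⁻¹ = Matrix.diagonal (fun i => (diagEntry k v φ ω x i)⁻¹) :=
    inv_diagonal_of_ne_zero (h.diagEntry_ne hx)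
  have hR : scalarCurvature (metric k v φ ω) x =
      ∑ j, (diagEntry k v φ ω x j)⁻¹ * ricci (metric k v φ ω) j j x := by
    rw [scalarCurvature, hinv]
    refine Finset.sum_congr rfl fun j _ => ?_
    rw [Finset.sum_eq_single j]
    · rw [Matrix.diagonal_apply_eq]
    · intro l _ hl
      rw [Matrix.diagonal_apply_ne _ hl.symm, zero_mul]
    · simp
  simp only [einstein, hR, Fin.sum_univ_four, r0, r1, r2, r3, hg, Matrix.diagonal_apply_eq, pressure]
  simp only [diagEntry, Matrix.cons_val]
  generalize dot v φ (x 0) / φ (x 0) * (dot v (fun t => ω t (x 1)) (x 0) / ω (x 0) (x 1)) = m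
  generalize dot v (dot v (fun t => ω t (x 1))) (x 0) / ω (x 0) (x 1) = n
  generalize σ v φ (x 0) = s
  generalize β v φ (x 0) = b
  generalize ξ k φ (x 0) = c
  refine ⟨?_, ?_, ?_⟩ <;> field_simp <;> ring

end Curvature

end TModel

namespace TModel

open Set Filter Topology

/-! The field equations and the kinematics of the fluid. -/

section Fluid

variable {k : ℝ} {I J : Set ℝ} {D : Set (ℝ × ℝ)} {v φ : ℝ → ℝ} {ω : ℝ → ℝ → ℝ} {ρ p : Pt → ℝ}
  {ω₁ ω₂ a Q : ℝ → ℝ}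

lemma IsTModel.isGeometry (hT : IsTModel k I J D v φ ω ρ p) : IsGeometry k I J D v φ ω where
  isOpen := hT.I_open
  isPreconnected := hT.I_connected.isPreconnected
  smooth := hT.v_smooth
  pos := hT.v_pos
  φ_smooth := hT.φ_smooth
  φ_pos := hT.φ_pos
  J_open := hT.J_open
  D_open := hT.D_open
  chart := hT.chart
  ω_smooth := hT.ω_smooth
  ω_pos := hT.ω_pos

lemma IsTModel.point (hT : IsTModel k I J D v φ ω ρ p) :
    ∃ z : ℝ × ℝ, ∀ t ∈ I, ∀ r ∈ J, (![t, r, z.1, z.2] : Pt) ∈ domain I J D := by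
  obtain ⟨z, hz⟩ := hT.D_connected.nonempty
  exact ⟨z, fun t ht r hr => ⟨ht, hr, hz⟩⟩

lemma lower_velocity (x : Pt) (i : Fin 4) :
    lower (metric k v φ ω) (velocity v) x i = if i = 0 then -(1 / v (x 0)) * √(v (x 0)) else 0 := by
  rw [lower, Finset.sum_eq_single 0]
  · split_ifs with h
    · subst h; simp [metric, velocity]
    · simp [metric, velocity, Matrix.diagonal_apply_ne _ h]
  · intro j _ hj
    simp [velocity, hj]
  · simp

/-- The components `11`, `00` and `22` give `p`, `ρ` and the evolution equation in turn; the last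
one says that the radial and angular pressures coincide. -/
lemma IsGeometry.fieldEq (h : IsGeometry k I J D v φ ω)
    (hG : IsPerfectFluidSolution (domain I J D) (metric k v φ ω) (velocity v) ρ p)
    {x : Pt} (hx : x ∈ domain I J D) :
    p x = pressure k v φ (x 0) ∧
      ρ x = 1 / 4 * β v φ (x 0) + ξ k φ (x 0)
        + dot v φ (x 0) / φ (x 0) * (dot v (fun t => ω t (x 1)) (x 0) / ω (x 0) (x 1)) ∧
      2 * φ (x 0) * dot v (dot v (fun t => ω t (x 1))) (x 0)
        + dot v φ (x 0) * dot v (fun t => ω t (x 1)) (x 0)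
        - (dot v (dot v φ) (x 0) + 2 * k) * ω (x 0) (x 1) = 0 := by
  obtain ⟨e0, e1, e2⟩ := h.einstein_diag hx
  have h1 := (h.pos _ hx.1).ne'
  have h2 := (h.ω_pos _ hx.1 _ hx.2.1).ne'
  have h3 := (h.φ_pos _ hx.1).ne'
  have h4 := h.conf_ne hx
  have hs : √(v (x 0)) ^ 2 = v (x 0) := Real.sq_sqrt (h.pos _ hx.1).le
  have hg : metric k v φ ω x = Matrix.diagonal (diagEntry k v φ ω x) := rfl
  have g0 := (hG x hx).2 0 0
  have g1 := (hG x hx).2 1 1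
  have g2 := (hG x hx).2 2 2
  rw [lower_velocity, e0, hg, Matrix.diagonal_apply_eq, if_pos rfl] at g0
  rw [lower_velocity, e1, hg, Matrix.diagonal_apply_eq, if_neg (by decide)] at g1
  rw [lower_velocity, e2, hg, Matrix.diagonal_apply_eq, if_neg (by decide)] at g2
  simp only [diagEntry, Matrix.cons_val] at g0 g1 g2
  have hp : p x = pressure k v φ (x 0) := by
    have : ω (x 0) (x 1) ^ 2 * (p x - pressure k v φ (x 0)) = 0 := by linear_combination -g1
    exact sub_eq_zero.1 ((mul_eq_zero.1 this).resolve_left (pow_ne_zero 2 h2))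
  refine ⟨hp, ?_, ?_⟩
  · have e : (ρ x + p x) * (-(1 / v (x 0)) * √(v (x 0))) * (-(1 / v (x 0)) * √(v (x 0)))
        + p x * -(1 / v (x 0)) = 1 / v (x 0) * ρ x := by
      have : (-(1 / v (x 0)) * √(v (x 0))) * (-(1 / v (x 0)) * √(v (x 0))) = 1 / v (x 0) := by
        field_simp
        exact hs
      rw [mul_assoc, this]
      ring
    rw [e] at g0
    exact (mul_left_cancel₀ (one_div_ne_zero h1) g0).symm
  · have e : φ (x 0) * conf k (x 2) (x 3) ^ 2 *
        (-(1 / 2 * σ v φ (x 0) - 1 / 4 * β v φ (x 0)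
          + dot v (dot v (fun t => ω t (x 1))) (x 0) / ω (x 0) (x 1)
          + 1 / 2 * (dot v φ (x 0) / φ (x 0)
            * (dot v (fun t => ω t (x 1)) (x 0) / ω (x 0) (x 1)))) - p x) = 0 := by
      linear_combination g2
    have e' := (mul_eq_zero.1 e).resolve_left (mul_ne_zero h3 (pow_ne_zero 2 h4))
    rw [hp] at e'
    simp only [pressure, σ, β, ξ] at e'
    field_simp at e'
    refine (mul_eq_zero.1 (?_ : 4 * φ (x 0) * _ = 0)).resolve_left (mul_ne_zero four_ne_zero h3)
    linear_combination -e'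

lemma IsTModel.solves (hT : IsTModel k I J D v φ ω ρ p) {r : ℝ} (hr : r ∈ J) :
    SolvesFieldEq k I v φ (fun t => ω t r) := by
  intro t ht
  obtain ⟨z, hz⟩ := hT.point
  exact (hT.isGeometry.fieldEq hT.perfectFluid (hz t ht r hr)).2.2

lemma IsClock.pd_velocity (h : IsClock I v) {x : Pt} (hx : x 0 ∈ I) (j i : Fin 4) :
    pd j (fun y => velocity v y i) x =
      if j = 0 ∧ i = 0 then deriv v (x 0) / (2 * √(v (x 0))) else 0 := by
  by_cases hi : i = 0
  · subst hi
    have e := (hasDerivAt_of_smooth h.isOpen h.smooth hx).sqrt (h.pos _ hx).ne'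
    have hd : DifferentiableAt ℝ (fun y : Pt => √(v (y 0))) x :=
      differentiableAt_time h.isOpen h.smooth_sqrt hx
    have hv : (fun y => velocity v y 0) = fun y : Pt => √(v (y 0)) := by
      funext y; simp [velocity]
    rw [hv]
    refine pd_eq_of_hasDerivAt hd ?_
    split_ifs with hj
    · obtain rfl := hj.1
      simpa using e
    · have : (0 : Fin 4) ≠ j := fun h => hj ⟨h.symm, rfl⟩
      simpa [Function.update_of_ne this] using hasDerivAt_const (x j) (√(v (x 0)))
  · simp [velocity, hi, pd]

lemma IsGeometry.acceleration_eq_zero (h : IsGeometry k I J D v φ ω) {x : Pt}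
    (hx : x ∈ domain I J D) : acceleration (metric k v φ ω) (velocity v) x = 0 := by
  have h1 := (h.pos _ hx.1).ne'
  have hs0 := (h.sqrt_pos hx.1).ne'
  have hs : √(v (x 0)) ^ 2 = v (x 0) := Real.sq_sqrt (h.pos _ hx.1).le
  funext i
  simp only [acceleration, h.pd_velocity hx.1, h.christoffel_eq hx, Fin.sum_univ_four]
  simp only [velocity]
  fin_cases i <;> simp [gam]
  -- Only the time component is not immediate: the derivative of `√v` cancels against `Γ⁰₀₀`.
  right
  field_simp
  rw [hs]
  ring

lemma IsGeometry.expansion_eq (h : IsGeometry k I J D v φ ω) {x : Pt}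
    (hx : x ∈ domain I J D) : expansion (metric k v φ ω) (velocity v) x =
      dot v φ (x 0) / φ (x 0) + dot v (fun t => ω t (x 1)) (x 0) / ω (x 0) (x 1) := by
  have h1 := (h.pos _ hx.1).ne'
  have h2 := (h.ω_pos _ hx.1 _ hx.2.1).ne'
  have h3 := (h.φ_pos _ hx.1).ne'
  have hs0 := (h.sqrt_pos hx.1).ne'
  have hs : √(v (x 0)) ^ 2 = v (x 0) := Real.sq_sqrt (h.pos _ hx.1).le
  simp only [expansion, h.pd_velocity hx.1, h.christoffel_eq hx, Fin.sum_univ_four]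
  simp only [velocity]
  simp [gam, dot]
  have : deriv v (x 0) / (2 * √(v (x 0))) = deriv v (x 0) / (2 * v (x 0)) * √(v (x 0)) := by
    field_simp
    rw [hs]
  rw [this]
  field_simp
  ring

/-- The metric function `ω` of a T-model has the normal form. -/
lemma IsTModel.exists_normalForm (hT : IsTModel k I J D v φ ω ρ p) :
    ∃ ω₁ ω₂ a Q : ℝ → ℝ, IsNormalForm k I J v φ ω ω₁ ω₂ a Q := by
  have h := hT.isGeometry
  obtain ⟨t₀, ht₀⟩ := hT.I_connected.nonempty
  obtain ⟨r₀, hr₀⟩ := hT.J_connected.nonempty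
  have hpos : ∀ r ∈ J, ω t₀ r ≠ 0 := fun r hr => (h.ω_pos t₀ ht₀ r hr).ne'
  have hsm : ContDiffOn ℝ (⊤ : ℕ∞) (fun r => dot v (fun t => ω t r) t₀) J :=
    contDiffOn_const.mul (h.smooth_deriv_left.comp (contDiffOn_const.prodMk contDiffOn_id)
      fun r hr => ⟨ht₀, hr⟩)
  -- Either two of the solutions `ω(·, r)` have independent initial data at `t₀`, and they span all
  -- the others, or every one is a multiple of `ω(·, r₀)`. No solution has to be constructed.
  by_cases hdep : ∃ r₁ ∈ J,
      ω t₀ r₀ * dot v (fun t => ω t r₁) t₀ - ω t₀ r₁ * dot v (fun t => ω t r₀) t₀ ≠ 0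
  · obtain ⟨r₁, hr₁, hW⟩ := hdep
    set W := ω t₀ r₀ * dot v (fun t => ω t r₁) t₀ - ω t₀ r₁ * dot v (fun t => ω t r₀) t₀ with hWdef
    -- the solutions with initial data `(1, 0)` and `(0, 1)` at `t₀`
    refine ⟨fun t => dot v (fun t => ω t r₁) t₀ / W * ω t r₀ + -(dot v (fun t => ω t r₀) t₀ / W) * ω t r₁,
      fun t => -(ω t₀ r₁ / W) * ω t r₀ + ω t₀ r₀ / W * ω t r₁, fun r => ω t₀ r,
      fun r => dot v (fun t => ω t r) t₀ / ω t₀ r, ?_⟩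
    have s0 := h.smooth_left hr₀
    have s1 := h.smooth_left hr₁
    have L : ∀ c d : ℝ, ContDiffOn ℝ (⊤ : ℕ∞) (fun t => c * ω t r₀ + d * ω t r₁) I := fun c d =>
      (contDiffOn_const.mul s0).add (contDiffOn_const.mul s1)
    have S : ∀ c d : ℝ, SolvesFieldEq k I v φ (fun t => c * ω t r₀ + d * ω t r₁) := fun c d =>
      SolvesFieldEq.lin h.toIsBackground s0 s1 (hT.solves hr₀) (hT.solves hr₁) c d
    refine ⟨L _ _, L _ _, h.smooth_right ht₀, hsm.div (h.smooth_right ht₀) hpos,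
      h.ω_pos t₀ ht₀, ?_, S _ _, S _ _⟩
    intro t ht r hr
    have hr0 := hpos r hr
    -- Cramer's rule: `A` and `B` are the coordinates of `ω(·, r)` in the basis `ω(·, r₀)`, `ω(·,
    -- r₁)`, read off from the data at `t₀`.
    set A := (ω t₀ r * dot v (fun t => ω t r₁) t₀ - ω t₀ r₁ * dot v (fun t => ω t r) t₀) / W
    set B := (ω t₀ r₀ * dot v (fun t => ω t r) t₀ - ω t₀ r * dot v (fun t => ω t r₀) t₀) / W
    have e := h.dependent (w₁ := fun t => ω t r) (w₂ := fun t => A * ω t r₀ + B * ω t r₁)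
      (h.smooth_left hr) (L A B) (hT.solves hr) (S A B) ht₀ (a := 1) (b := -1)
      (by simp only [A, B]; field_simp; rw [hWdef]; ring)
      (by rw [h.dot_lin s0 s1 A B ht₀]; simp only [A, B]; field_simp; rw [hWdef]; ring) ht
    have e' : ω t r = A * ω t r₀ + B * ω t r₁ := by linear_combination e
    rw [e']
    simp only [A, B]
    field_simp
    ring
  · push Not at hdep
    refine ⟨fun t => ω t r₀, fun _ => 0, fun r => ω t₀ r / ω t₀ r₀, fun _ => 0,
      h.smooth_left hr₀, contDiffOn_const, (h.smooth_right ht₀).div contDiffOn_const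
        fun _ _ => hpos r₀ hr₀, contDiffOn_const,
      fun r hr => div_pos (h.ω_pos t₀ ht₀ r hr) (h.ω_pos t₀ ht₀ r₀ hr₀), ?_, hT.solves hr₀, ?_⟩
    · intro t ht r hr
      have hr0 := hpos r₀ hr₀
      have e := h.dependent (w₁ := fun t => ω t r) (w₂ := fun t => ω t r₀)
        (h.smooth_left hr) (h.smooth_left hr₀) (hT.solves hr) (hT.solves hr₀) ht₀
        (a := ω t₀ r₀) (b := -ω t₀ r) (by ring) (by linear_combination hdep r hr) ht
      field_simp
      linear_combination e
    · intro t ht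
      have h0 : dot v (fun _ => (0 : ℝ)) = fun _ => 0 := by funext s; simp [dot]
      simp [h0]

end Fluid

end TModel

namespace TModel

open Set Filter Topology

/-! Thermodynamic schemes. -/

section Schemes

variable {k : ℝ} {I J : Set ℝ} {D : Set (ℝ × ℝ)} {v φ : ℝ → ℝ} {ω : ℝ → ℝ → ℝ} {ρ p : Pt → ℝ}
  {ω₁ ω₂ a Q : ℝ → ℝ}

/-- The comoving volume `φ (ω₁ + ω₂ Q)`. -/
noncomputable def vol (φ ω₁ ω₂ Q : ℝ → ℝ) (x : Pt) : ℝ :=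
  φ (x 0) * (ω₁ (x 0) + ω₂ (x 0) * Q (x 1))

/-- The enthalpy `(ρ + p) φ (ω₁ + ω₂ Q) = λ₁ + λ₂ Q` in the comoving volume. -/
noncomputable def enth (v φ ω₁ ω₂ Q : ℝ → ℝ) (x : Pt) : ℝ :=
  lam v φ ω₁ (x 0) + lam v φ ω₂ (x 0) * Q (x 1)

/-- The coordinate `x_i` as a linear form. -/
noncomputable def dx (i : Fin 4) : Pt →L[ℝ] ℝ := ContinuousLinearMap.proj i

@[simp] lemma dx_apply (i : Fin 4) (X : Pt) : dx i X = X i := rfl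

lemma hasFDerivAt_comp_coord {f : ℝ → ℝ} {f' : ℝ} {i : Fin 4} {x : Pt}
    (hf : HasDerivAt f f' (x i)) : HasFDerivAt (fun y : Pt => f (y i)) (f' • dx i) x :=
  hf.comp_hasFDerivAt (f := fun y : Pt => y i) x (hasFDerivAt_apply i x)

lemma along_velocity (f : Pt → ℝ) (x : Pt) : along (velocity v) f x = √(v (x 0)) * pd 0 f x := by
  have : velocity v x = √(v (x 0)) • (Pi.single 0 1 : Pt) := by
    rw [velocity, ← Pi.single_smul, smul_eq_mul, mul_one]
  rw [along, this, map_smul, smul_eq_mul, pd]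

lemma pd_of_hasFDerivAt {f : Pt → ℝ} {f' : Pt →L[ℝ] ℝ} {x : Pt} (hf : HasFDerivAt f f' x)
    (i : Fin 4) : pd i f x = f' (Pi.single i 1) := by
  rw [pd, hf.fderiv]

lemma IsNormalForm.dot_eq (hn : IsNormalForm k I J v φ ω ω₁ ω₂ a Q) (h : IsClock I v) {t r : ℝ}
    (ht : t ∈ I) (hr : r ∈ J) :
    dot v (fun t => ω t r) t = (dot v ω₁ t + dot v ω₂ t * Q r) * a r := by
  rw [dot_congr h.isOpen (g := fun t => a r * ω₁ t + Q r * a r * ω₂ t)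
    (fun s hs => by simp only [hn.ω_eq s hs r hr]; ring) ht,
    h.dot_lin hn.ω₁_smooth hn.ω₂_smooth _ _ ht]
  ring

lemma IsNormalForm.pos (hn : IsNormalForm k I J v φ ω ω₁ ω₂ a Q)
    (hω : ∀ t ∈ I, ∀ r ∈ J, 0 < ω t r) {t r : ℝ} (ht : t ∈ I) (hr : r ∈ J) :
    0 < ω₁ t + ω₂ t * Q r := by
  have := hω t ht r hr
  rw [hn.ω_eq t ht r hr] at this
  exact pos_of_mul_pos_left this (hn.a_pos r hr).le

lemma IsNormalForm.dot_div (hn : IsNormalForm k I J v φ ω ω₁ ω₂ a Q) (h : IsClock I v) {t r : ℝ}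
    (ht : t ∈ I) (hr : r ∈ J) :
    dot v (fun t => ω t r) t / ω t r = (dot v ω₁ t + dot v ω₂ t * Q r) / (ω₁ t + ω₂ t * Q r) := by
  rw [hn.dot_eq h ht hr, hn.ω_eq t ht r hr, mul_div_mul_right _ _ (hn.a_pos r hr).ne']

lemma IsTModel.vol_ne (hT : IsTModel k I J D v φ ω ρ p) (hn : IsNormalForm k I J v φ ω ω₁ ω₂ a Q)
    {x : Pt} (hx : x ∈ domain I J D) : vol φ ω₁ ω₂ Q x ≠ 0 :=
  mul_ne_zero (hT.φ_pos _ hx.1).ne' (hn.pos hT.ω_pos hx.1 hx.2.1).ne'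

lemma IsTModel.p_eq (hT : IsTModel k I J D v φ ω ρ p) {x : Pt} (hx : x ∈ domain I J D) :
    p x = pressure k v φ (x 0) :=
  (hT.isGeometry.fieldEq hT.perfectFluid hx).1

lemma IsTModel.ρ_eq (hT : IsTModel k I J D v φ ω ρ p) (hn : IsNormalForm k I J v φ ω ω₁ ω₂ a Q)
    {x : Pt} (hx : x ∈ domain I J D) :
    ρ x = enth v φ ω₁ ω₂ Q x / vol φ ω₁ ω₂ Q x - pressure k v φ (x 0) := by
  have h := hT.isGeometry
  have h1 := (h.φ_pos _ hx.1).ne'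
  have h2 := (hn.pos hT.ω_pos hx.1 hx.2.1).ne'
  rw [(h.fieldEq hT.perfectFluid hx).2.1, hn.dot_div h.toIsClock hx.1 hx.2.1]
  simp only [enth, vol, lam, pressure, β, σ, ξ]
  -- Eliminating `ω₁` in favour of `W` makes the nonvanishing denominator an atom.
  obtain ⟨W, hW⟩ : ∃ W, W = ω₁ (x 0) + ω₂ (x 0) * Q (x 1) := ⟨_, rfl⟩
  rw [← hW] at h2 ⊢
  rw [show ω₁ (x 0) = W - ω₂ (x 0) * Q (x 1) by rw [hW]; ring]
  field_simp
  ring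

lemma IsTModel.vol_mul_expansion (hT : IsTModel k I J D v φ ω ρ p)
    (hn : IsNormalForm k I J v φ ω ω₁ ω₂ a Q) {x : Pt} (hx : x ∈ domain I J D) :
    vol φ ω₁ ω₂ Q x * expansion (metric k v φ ω) (velocity v) x =
      dot v φ (x 0) * (ω₁ (x 0) + ω₂ (x 0) * Q (x 1))
        + φ (x 0) * (dot v ω₁ (x 0) + dot v ω₂ (x 0) * Q (x 1)) := by
  have h := hT.isGeometry
  have h1 := (h.φ_pos _ hx.1).ne'
  have h2 := (hn.pos hT.ω_pos hx.1 hx.2.1).ne'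
  rw [h.expansion_eq hx, hn.dot_div h.toIsClock hx.1 hx.2.1, vol]
  field_simp

lemma IsTModel.hasFDerivAt_pressure (hT : IsTModel k I J D v φ ω ρ p) {x : Pt}
    (hx : x ∈ domain I J D) :
    HasFDerivAt (fun y : Pt => pressure k v φ (y 0))
      ((dot v (pressure k v φ) (x 0) / √(v (x 0))) • dx 0) x :=
  have h := hT.isGeometry
  hasFDerivAt_comp_coord (h.hasDerivAt h.pressure_smooth hx.1)

lemma IsTModel.hasFDerivAt_vol (hT : IsTModel k I J D v φ ω ρ p)
    (hn : IsNormalForm k I J v φ ω ω₁ ω₂ a Q) {x : Pt} (hx : x ∈ domain I J D) :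
    HasFDerivAt (vol φ ω₁ ω₂ Q)
      ((vol φ ω₁ ω₂ Q x * expansion (metric k v φ ω) (velocity v) x / √(v (x 0))) • dx 0
        + (φ (x 0) * ω₂ (x 0) * deriv Q (x 1)) • dx 1) x := by
  have h := hT.isGeometry
  have e := (hasFDerivAt_comp_coord (h.hasDerivAt h.φ_smooth hx.1)).fun_mul
    ((hasFDerivAt_comp_coord (h.hasDerivAt hn.ω₁_smooth hx.1)).fun_add
      ((hasFDerivAt_comp_coord (h.hasDerivAt hn.ω₂_smooth hx.1)).fun_mul
        (hasFDerivAt_comp_coord (hasDerivAt_of_smooth hT.J_open hn.Q_smooth hx.2.1))))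
  rw [hT.vol_mul_expansion hn hx]
  refine e.congr_fderiv ?_
  ext X
  simp
  ring

lemma IsTModel.hasFDerivAt_enth (hT : IsTModel k I J D v φ ω ρ p)
    (hn : IsNormalForm k I J v φ ω ω₁ ω₂ a Q) {x : Pt} (hx : x ∈ domain I J D) :
    HasFDerivAt (enth v φ ω₁ ω₂ Q)
      ((dot v (pressure k v φ) (x 0) * vol φ ω₁ ω₂ Q x / √(v (x 0))) • dx 0
        + (lam v φ ω₂ (x 0) * deriv Q (x 1)) • dx 1) x := by
  have h := hT.isGeometry
  have e1 := h.hasDerivAt (h.lam_smooth hn.ω₁_smooth) hx.1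
  have e2 := h.hasDerivAt (h.lam_smooth hn.ω₂_smooth) hx.1
  rw [h.dot_lam hn.ω₁_smooth hn.ω₁_solves hx.1] at e1
  rw [h.dot_lam hn.ω₂_smooth hn.ω₂_solves hx.1] at e2
  have e := (hasFDerivAt_comp_coord e1).fun_add ((hasFDerivAt_comp_coord e2).fun_mul
    (hasFDerivAt_comp_coord (hasDerivAt_of_smooth hT.J_open hn.Q_smooth hx.2.1)))
  refine e.congr_fderiv ?_
  ext X
  simp [vol]
  ring

/-- Energy conservation comes from differentiating `(ρ + p) V = λ₁ + λ₂ Q` in time: the right side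
changes at the rate `ṗ V`, which cancels the pressure term, and `V` changes at the rate `V θ`. -/
lemma IsTModel.pd_ρ (hT : IsTModel k I J D v φ ω ρ p)
    (hn : IsNormalForm k I J v φ ω ω₁ ω₂ a Q) {x : Pt} (hx : x ∈ domain I J D) :
    DifferentiableAt ℝ ρ x ∧ (∀ i, i ≠ 0 → i ≠ 1 → pd i ρ x = 0) ∧
      √(v (x 0)) * pd 0 ρ x = -((ρ x + p x) * expansion (metric k v φ ω) (velocity v) x) := by
  have hV := hT.vol_ne hn hx
  have hs := (hT.isGeometry.sqrt_pos hx.1).ne'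
  have e := (((hT.hasFDerivAt_enth hn hx).fun_mul ((hasDerivAt_inv hV).comp_hasFDerivAt x
    (hT.hasFDerivAt_vol hn hx))).fun_sub (hT.hasFDerivAt_pressure hx)).congr_of_eventuallyEq
    (f₁ := ρ) (by
      filter_upwards [hT.isGeometry.isOpen_domain.mem_nhds hx] with y hy
      rw [hT.ρ_eq hn hy, div_eq_mul_inv]
      rfl)
  refine ⟨e.differentiableAt, fun i h0 h1 => ?_, ?_⟩
  · rw [pd_of_hasFDerivAt e]
    simp [h0.symm, h1.symm]
  · rw [pd_of_hasFDerivAt e, hT.ρ_eq hn hx, hT.p_eq hx]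
    simp
    field_simp
    ring

lemma IsTModel.pd_p (hT : IsTModel k I J D v φ ω ρ p) {x : Pt} (hx : x ∈ domain I J D) :
    DifferentiableAt ℝ p x ∧ (∀ i, i ≠ 0 → pd i p x = 0) ∧
      √(v (x 0)) * pd 0 p x = dot v (pressure k v φ) (x 0) := by
  have hs := (hT.isGeometry.sqrt_pos hx.1).ne'
  have e := (hT.hasFDerivAt_pressure hx).congr_of_eventuallyEq (f₁ := p) (by
      filter_upwards [hT.isGeometry.isOpen_domain.mem_nhds hx] with y hy
      exact hT.p_eq hy)
  refine ⟨e.differentiableAt, fun i h0 => ?_, ?_⟩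
  · rw [pd_of_hasFDerivAt e]
    simp [h0.symm]
  · rw [pd_of_hasFDerivAt e]
    simp
    field_simp

lemma IsTModel.isPerfectEnergyTensor (hT : IsTModel k I J D v φ ω ρ p)
    (hn : IsNormalForm k I J v φ ω ω₁ ω₂ a Q) :
    IsPerfectEnergyTensor (domain I J D) (metric k v φ ω) (velocity v) ρ p := by
  intro x hx
  have h1 := (hT.v_pos _ hx.1).ne'
  have hs : √(v (x 0)) ^ 2 = v (x 0) := Real.sq_sqrt (hT.v_pos _ hx.1).le
  constructor
  · intro i
    have ha : lower (metric k v φ ω) (acceleration (metric k v φ ω) (velocity v)) x i = 0 := by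
      simp [lower, hT.isGeometry.acceleration_eq_zero hx]
    rw [ha, lower_velocity, along_velocity]
    split_ifs with h
    · subst h
      field_simp
      rw [hs]
      ring
    · rw [(hT.pd_p hx).2.1 i h]
      ring
  · rw [along_velocity, (hT.pd_ρ hn hx).2.2]
    ring

/-- The thermodynamic laws for `n = 1 / (φ (ω₁ + ω₂ Q) M)` and `ε = ρ / n - 1`. -/
lemma IsTModel.laws (hT : IsTModel k I J D v φ ω ρ p)
    (hn : IsNormalForm k I J v φ ω ω₁ ω₂ a Q) {n ε M : Pt → ℝ} {M' : Pt →L[ℝ] ℝ}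
    (hM0 : ∀ x ∈ domain I J D, M x ≠ 0)
    (hnM : ∀ x ∈ domain I J D, n x = 1 / (vol φ ω₁ ω₂ Q x * M x))
    (hε : ∀ x ∈ domain I J D, ε x = ρ x / n x - 1) {x : Pt} (hx : x ∈ domain I J D)
    (hM : HasFDerivAt M M' x) :
    along (velocity v) n x + n x * expansion (metric k v φ ω) (velocity v) x =
        -(√(v (x 0)) * M' (Pi.single 0 1) / (vol φ ω₁ ω₂ Q x * M x ^ 2)) ∧
      fderiv ℝ ε x + p x • fderiv ℝ (fun y => 1 / n y) x =
        enth v φ ω₁ ω₂ Q x • M' + (M x * lam v φ ω₂ (x 0) * deriv Q (x 1)) • dx 1 := by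
  have hU := hT.isGeometry.isOpen_domain.mem_nhds hx
  have hV := hT.vol_ne hn hx
  have hMx := hM0 x hx
  have hs := (hT.isGeometry.sqrt_pos hx.1).ne'
  have e1 := (hT.hasFDerivAt_vol hn hx).fun_mul hM
  constructor
  · have e2 := ((hasDerivAt_inv (mul_ne_zero hV hMx)).comp_hasFDerivAt x e1).congr_of_eventuallyEq
      (f₁ := n) (by
        filter_upwards [hU] with y hy
        rw [hnM y hy, one_div]
        rfl)
    rw [along_velocity, pd_of_hasFDerivAt e2, hnM x hx]
    simp
    field_simp
    ring
  · have e2 := e1.congr_of_eventuallyEq (f₁ := fun y => 1 / n y) (by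
      filter_upwards [hU] with y hy
      rw [hnM y hy, one_div_one_div])
    -- Here `ε + 1 = ρ V M` is written as `((ρ + p) V - p V) M`. After `p d(V M)` is added, the term
    -- `V M dp` cancels against the one in the differential of the enthalpy.
    have e3 := ((((hT.hasFDerivAt_enth hn hx).fun_sub ((hT.hasFDerivAt_pressure hx).fun_mul
      (hT.hasFDerivAt_vol hn hx))).fun_mul hM).sub_const 1).congr_of_eventuallyEq (f₁ := ε) (by
        filter_upwards [hU] with y hy
        have := hT.vol_ne hn hy
        rw [hε y hy, hnM y hy, hT.ρ_eq hn hy]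
        field_simp)
    rw [e2.fderiv, e3.fderiv, hT.p_eq hx]
    ext X
    simp
    field_simp
    ring

lemma contDiffOn_coord {s : Set ℝ} {U : Set Pt} {f : ℝ → ℝ} {i : Fin 4} (hf : ContDiffOn ℝ 1 f s)
    (hU : ∀ x ∈ U, x i ∈ s) : ContDiffOn ℝ 1 (fun x : Pt => f (x i)) U :=
  hf.comp (contDiff_apply ℝ ℝ i).contDiffOn hU

lemma IsTModel.contDiffOn_vol (hT : IsTModel k I J D v φ ω ρ p)
    (hn : IsNormalForm k I J v φ ω ω₁ ω₂ a Q) :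
    ContDiffOn ℝ 1 (vol φ ω₁ ω₂ Q) (domain I J D) := by
  have c0 : ∀ f, ContDiffOn ℝ (⊤ : ℕ∞) f I → ContDiffOn ℝ 1 (fun x : Pt => f (x 0)) (domain I J D) :=
    fun f hf => contDiffOn_coord (hf.of_le (by exact_mod_cast le_top)) fun x hx => hx.1
  exact (c0 φ hT.φ_smooth).mul ((c0 _ hn.ω₁_smooth).add ((c0 _ hn.ω₂_smooth).mul
    (contDiffOn_coord (hn.Q_smooth.of_le (by exact_mod_cast le_top)) fun x hx => hx.2.1)))

lemma IsTModel.contDiffOn_ρ (hT : IsTModel k I J D v φ ω ρ p)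
    (hn : IsNormalForm k I J v φ ω ω₁ ω₂ a Q) : ContDiffOn ℝ 1 ρ (domain I J D) := by
  have h := hT.isGeometry
  have c0 : ∀ f, ContDiffOn ℝ (⊤ : ℕ∞) f I → ContDiffOn ℝ 1 (fun x : Pt => f (x 0)) (domain I J D) :=
    fun f hf => contDiffOn_coord (hf.of_le (by exact_mod_cast le_top)) fun x hx => hx.1
  have hL : ContDiffOn ℝ 1 (enth v φ ω₁ ω₂ Q) (domain I J D) :=
    (c0 _ (h.lam_smooth hn.ω₁_smooth)).add ((c0 _ (h.lam_smooth hn.ω₂_smooth)).mul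
      (contDiffOn_coord (hn.Q_smooth.of_le (by exact_mod_cast le_top)) fun x hx => hx.2.1))
  exact ((hL.div (hT.contDiffOn_vol hn) fun x hx => hT.vol_ne hn hx).sub
    (c0 _ h.pressure_smooth)).congr fun x hx => hT.ρ_eq hn hx

/-- Sufficient conditions for a thermodynamic scheme, in terms of functions of `r`. -/
lemma IsTModel.isThermodynamicScheme (hT : IsTModel k I J D v φ ω ρ p)
    (hn : IsNormalForm k I J v φ ω ω₁ ω₂ a Q) {n ε s Θ : Pt → ℝ} {S N : ℝ → ℝ}
    (hS : ContDiffOn ℝ 1 S J) (hN : ContDiffOn ℝ 1 N J) (hN0 : ∀ r ∈ J, N r ≠ 0)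
    (hs : ∀ x ∈ domain I J D, s x = S (x 1))
    (hnN : ∀ x ∈ domain I J D, n x = 1 / (vol φ ω₁ ω₂ Q x * N (x 1)))
    (hε : ∀ x ∈ domain I J D, ε x = ρ x / n x - 1)
    (hΘ : ∀ x ∈ domain I J D, Θ x * deriv S (x 1) =
      deriv N (x 1) * enth v φ ω₁ ω₂ Q x + N (x 1) * lam v φ ω₂ (x 0) * deriv Q (x 1)) :
    IsThermodynamicScheme (domain I J D) (metric k v φ ω) (velocity v) ρ p n ε s Θ := by
  have hU := hT.isGeometry.isOpen_domain
  have hM0 : ∀ x ∈ domain I J D, N (x 1) ≠ 0 := fun x hx => hN0 _ hx.2.1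
  have hn0 : ∀ x ∈ domain I J D, n x ≠ 0 := fun x hx => by
    rw [hnN x hx]
    exact one_div_ne_zero (mul_ne_zero (hT.vol_ne hn hx) (hM0 x hx))
  have hnc : ContDiffOn ℝ 1 n (domain I J D) :=
    (contDiffOn_const.div ((hT.contDiffOn_vol hn).mul (contDiffOn_coord hN fun x hx => hx.2.1))
      fun x hx => mul_ne_zero (hT.vol_ne hn hx) (hM0 x hx)).congr hnN
  have hd : ∀ {f : ℝ → ℝ} {x : Pt}, ContDiffOn ℝ 1 f J → x ∈ domain I J D →
      HasDerivAt f (deriv f (x 1)) (x 1) := fun hf hx =>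
    ((hf.contDiffAt (hT.J_open.mem_nhds hx.2.1)).differentiableAt (by simp)).hasDerivAt
  have hlaws := fun x hx => hT.laws hn hM0 hnN hε (x := x) hx (hasFDerivAt_comp_coord (hd hN hx))
  refine ⟨hnc, (((hT.contDiffOn_ρ hn).div hnc hn0).sub contDiffOn_const).congr hε,
    (contDiffOn_coord hS fun x hx => hx.2.1).congr hs, hn0, fun x hx => ?_, fun x hx => ?_,
    fun x hx => ?_⟩
  · rw [(hlaws x hx).1]
    simp
  · have := hn0 x hx
    rw [hε x hx]
    field_simp
    ring
  · have e : HasFDerivAt s (deriv S (x 1) • dx 1) x :=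
      (hasFDerivAt_comp_coord (hd hS hx)).congr_of_eventuallyEq (hU.mem_nhds hx |> fun h => by
        filter_upwards [h] with y hy using hs y hy)
    rw [(hlaws x hx).2, e.fderiv]
    ext X
    simp
    linear_combination X 1 * hΘ x hx

/-- The scheme with `N = 1`, `s = Q` and `Θ = λ₂` works for every T-model, even if `Q` is constant,
since a scheme may have `ds = 0`. -/
lemma IsTModel.evolvesInLTE (hT : IsTModel k I J D v φ ω ρ p) :
    EvolvesInLTE (domain I J D) (metric k v φ ω) (velocity v) ρ p := by
  obtain ⟨ω₁, ω₂, a, Q, hn⟩ := hT.exists_normalForm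
  refine ⟨hT.isPerfectEnergyTensor hn, fun x => 1 / (vol φ ω₁ ω₂ Q x * 1),
    fun x => ρ x / (1 / (vol φ ω₁ ω₂ Q x * 1)) - 1, fun x => Q (x 1), fun x => lam v φ ω₂ (x 0), ?_⟩
  exact hT.isThermodynamicScheme hn (S := Q) (N := fun _ => 1)
    (hn.Q_smooth.of_le (by exact_mod_cast le_top)) contDiffOn_const (fun _ _ => one_ne_zero)
    (fun _ _ => rfl) (fun _ _ => rfl) (fun _ _ => rfl) (fun x _ => by simp)

end Schemes

end TModel

namespace TModel

open Set Filter Topology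

/-! ### Functions that depend on the radial coordinate only. -/

section Radial

variable {I J : Set ℝ} {D : Set (ℝ × ℝ)} {f : Pt → ℝ}

lemma update_mem_domain {x : Pt} (hx : x ∈ domain I J D) {t : ℝ} (ht : t ∈ I) :
    Function.update x 0 t ∈ domain I J D := by
  refine ⟨?_, ?_, ?_⟩
  · simpa using ht
  · simpa [Function.update] using hx.2.1
  · simpa [Function.update] using hx.2.2

lemma eq_of_pd_zero (hI : IsOpen I) (hI' : IsPreconnected I)
    (hf : ∀ x ∈ domain I J D, DifferentiableAt ℝ f x) (h0 : ∀ x ∈ domain I J D, pd 0 f x = 0)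
    {x : Pt} (hx : x ∈ domain I J D) {t : ℝ} (ht : t ∈ I) : f (Function.update x 0 t) = f x := by
  have e : ∀ s ∈ I, HasDerivAt (fun s => f (Function.update x 0 s)) 0 s := fun s hs => by
    have hy := update_mem_domain hx hs
    have := hasDerivAt_comp_update 0 (hf _ hy)
    rw [h0 _ hy] at this
    simpa using this
  have := hI.is_const_of_deriv_eq_zero hI'
    (fun s hs => (e s hs).differentiableAt.differentiableWithinAt) (fun s hs => (e s hs).deriv)
    ht hx.1
  simpa using this

lemma pd_update_time (hU : IsOpen (domain I J D))
    (hf : ∀ x ∈ domain I J D, DifferentiableAt ℝ f x)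
    (h0 : ∀ x ∈ domain I J D, ∀ t ∈ I, f (Function.update x 0 t) = f x)
    {x : Pt} (hx : x ∈ domain I J D) {t : ℝ} (ht : t ∈ I) {i : Fin 4} (hi : i ≠ 0) :
    pd i f (Function.update x 0 t) = pd i f x := by
  refine pd_eq_of_hasDerivAt (hf _ (update_mem_domain hx ht)) ?_
  rw [Function.update_of_ne hi]
  refine (hasDerivAt_comp_update i (hf x hx)).congr_of_eventuallyEq ?_
  have hc : ContinuousAt (fun s => Function.update x i s) (x i) :=
    (hasDerivAt_update x i (x i)).continuousAt
  have hm : domain I J D ∈ 𝓝 (Function.update x i (x i)) := by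
    simpa using hU.mem_nhds hx
  filter_upwards [hc hm] with s hs
  rw [Function.update_comm hi.symm]
  exact h0 _ hs t ht

/-- Since `D` is connected and open, vanishing `x` and `y` derivatives make `f` constant on each
slice of fixed `t` and `r`; the time coordinate is then moved freely. -/
lemma eq_radial (hD : IsOpen D) (hD' : IsPreconnected D)
    (hf : ∀ x ∈ domain I J D, DifferentiableAt ℝ f x)
    (h0 : ∀ x ∈ domain I J D, ∀ t ∈ I, f (Function.update x 0 t) = f x)
    (h2 : ∀ x ∈ domain I J D, pd 2 f x = 0) (h3 : ∀ x ∈ domain I J D, pd 3 f x = 0)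
    {t : ℝ} (ht : t ∈ I) {z : ℝ × ℝ} (hz : z ∈ D) {x : Pt} (hx : x ∈ domain I J D) :
    f x = f ![t, x 1, z.1, z.2] := by
  have hmem : ∀ w ∈ D, (![x 0, x 1, w.1, w.2] : Pt) ∈ domain I J D := fun w hw =>
    ⟨hx.1, hx.2.1, hw⟩
  have e : ∀ w ∈ D, HasFDerivAt (fun w : ℝ × ℝ => f ![x 0, x 1, w.1, w.2])
      (0 : ℝ × ℝ →L[ℝ] ℝ) w := by
    intro w hw
    have hg : HasFDerivAt (fun w : ℝ × ℝ => (![x 0, x 1, w.1, w.2] : Pt))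
        (ContinuousLinearMap.pi (![0, 0, ContinuousLinearMap.fst ℝ ℝ ℝ,
          ContinuousLinearMap.snd ℝ ℝ ℝ] : Fin 4 → (ℝ × ℝ →L[ℝ] ℝ))) w := by
      refine hasFDerivAt_pi'' ?_
      intro i
      fin_cases i
      · exact hasFDerivAt_const (x 0) w
      · exact hasFDerivAt_const (x 1) w
      · exact hasFDerivAt_fst (𝕜 := ℝ) (E := ℝ) (F := ℝ)
      · exact hasFDerivAt_snd (𝕜 := ℝ) (E := ℝ) (F := ℝ)
    refine ((hf _ (hmem w hw)).hasFDerivAt.comp w hg).congr_fderiv ?_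
    have hX : ∀ X : ℝ × ℝ, (ContinuousLinearMap.pi (![0, 0, ContinuousLinearMap.fst ℝ ℝ ℝ,
        ContinuousLinearMap.snd ℝ ℝ ℝ] : Fin 4 → (ℝ × ℝ →L[ℝ] ℝ))) X
        = X.1 • (Pi.single 2 1 : Pt) + X.2 • (Pi.single 3 1 : Pt) := by
      intro X
      funext i
      fin_cases i <;> simp
    refine ContinuousLinearMap.ext fun X => ?_
    rw [ContinuousLinearMap.comp_apply, hX, map_add, map_smul, map_smul]
    have e2 := h2 _ (hmem w hw)
    have e3 := h3 _ (hmem w hw)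
    rw [pd] at e2 e3
    rw [e2, e3]
    simp
  have key : f ![x 0, x 1, x 2, x 3] = f ![x 0, x 1, z.1, z.2] :=
    hD.is_const_of_fderiv_eq_zero hD'
    (fun w hw => (e w hw).differentiableAt.differentiableWithinAt) (fun w hw => (e w hw).fderiv)
    (x := (x 2, x 3)) hx.2.2 hz
  have hx' : (![x 0, x 1, x 2, x 3] : Pt) = x := by
    funext i; fin_cases i <;> rfl
  rw [hx'] at key
  rw [key, ← h0 _ (hmem z hz) t ht]
  congr 1
  funext i; fin_cases i <;> rfl

end Radial

/-! ### Inverting `Q` on the interval `J`. -/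

section Inverse

variable {J : Set ℝ} {Q : ℝ → ℝ}

lemma injOn_of_deriv_ne_zero (hJ : IsPreconnected J) (hd : ∀ r ∈ J, DifferentiableAt ℝ Q r)
    (h0 : ∀ r ∈ J, deriv Q r ≠ 0) : InjOn Q J := by
  have key : ∀ r ∈ J, ∀ s ∈ J, r < s → Q r ≠ Q s := by
    intro r hr s hs hrs heq
    have hsub : Icc r s ⊆ J := hJ.ordConnected.out hr hs
    obtain ⟨c, hc, hc0⟩ := exists_deriv_eq_zero hrs
      (fun u hu => (hd u (hsub hu)).continuousAt.continuousWithinAt) heq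
    exact h0 c (hsub (Ioo_subset_Icc_self hc)) hc0
  intro r hr s hs heq
  rcases lt_trichotomy r s with h | h | h
  · exact absurd heq (key r hr s hs h)
  · exact h
  · exact absurd heq.symm (key s hs r hr h)

/-- A smooth function with nonvanishing derivative on an open interval has an inverse. -/
lemma exists_inverse (hJ : IsOpen J) (hJ' : IsPreconnected J)
    (hQ : ContDiffOn ℝ (⊤ : ℕ∞) Q J) (h0 : ∀ r ∈ J, deriv Q r ≠ 0) :
    IsOpen (Q '' J) ∧ ∃ R : ℝ → ℝ, ContDiffOn ℝ 1 R (Q '' J) ∧ ∀ r ∈ J, R (Q r) = r := by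
  have hinj := injOn_of_deriv_ne_zero hJ' (fun r hr =>
    (hasDerivAt_of_smooth hJ hQ hr).differentiableAt) h0
  have hstrict : ∀ r ∈ J, HasStrictDerivAt Q (deriv Q r) r := fun r hr =>
    (hQ.contDiffAt (hJ.mem_nhds hr)).hasStrictDerivAt (by simp)
  have hleft : ∀ r ∈ J, Function.invFunOn Q J (Q r) = r := fun r hr =>
    hinj.leftInvOn_invFunOn hr
  refine ⟨?_, Function.invFunOn Q J, ?_, hleft⟩
  · rw [isOpen_iff_mem_nhds]
    rintro _ ⟨r, hr, rfl⟩
    rw [← (hstrict r hr).map_nhds_eq (h0 r hr)]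
    exact image_mem_map (hJ.mem_nhds hr)
  · rintro _ ⟨r, hr, rfl⟩
    have hc : ContDiffAt ℝ (1 : ℕ) Q r :=
      (hQ.contDiffAt (hJ.mem_nhds hr)).of_le (by exact_mod_cast le_top)
    let e := ContinuousLinearEquiv.unitsEquivAut ℝ (Units.mk0 _ (h0 r hr))
    have hd : HasFDerivAt Q (e : ℝ →L[ℝ] ℝ) r := by
      have := (hasDerivAt_of_smooth hJ hQ hr).hasFDerivAt
      refine this.congr_fderiv ?_
      ext
      simp [e]
    have hs : HasStrictFDerivAt Q (e : ℝ →L[ℝ] ℝ) r := hc.hasStrictFDerivAt' hd (by simp)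
    have hg := hc.to_localInverse hd (by simp)
    -- The global inverse agrees near `Q r` with the local one of the inverse function theorem,
    -- whose values stay in `J`, so it inherits its regularity.
    refine ContDiffAt.contDiffWithinAt (hg.congr_of_eventuallyEq ?_)
    have hcont : Tendsto (hs.localInverse Q e r) (𝓝 (Q r)) (𝓝 r) := hs.localInverse_tendsto
    filter_upwards [hcont (hJ.mem_nhds hr), hs.eventually_right_inverse] with y hy hy'
    have := hleft _ hy
    rwa [hy'] at this

end Inverse

/-! ### Every scheme of a regular T-model is radial. -/

section Schemes

variable {k : ℝ} {I J : Set ℝ} {D : Set (ℝ × ℝ)} {v φ : ℝ → ℝ} {ω : ℝ → ℝ → ℝ} {ρ p : Pt → ℝ}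
  {ω₁ ω₂ a Q : ℝ → ℝ} {n ε s Θ : Pt → ℝ}

lemma enth_update {x : Pt} (t : ℝ) : enth v φ ω₁ ω₂ Q (Function.update x 0 t) =
    lam v φ ω₁ t + lam v φ ω₂ t * Q (x 1) := by
  simp [enth, Function.update]

/-- In any thermodynamic scheme of a regular T-model, `s` and `1 / (n φ (ω₁ + ω₂ Q))` are functions
of `r`. -/
lemma IsTModel.scheme_radial (hT : IsTModel k I J D v φ ω ρ p)
    (hn : IsNormalForm k I J v φ ω ω₁ ω₂ a Q) (hr : IsRegular k I J v φ ω₁ ω₂ Q)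
    (hs : IsThermodynamicScheme (domain I J D) (metric k v φ ω) (velocity v) ρ p n ε s Θ) :
    ∃ S N : ℝ → ℝ, ContDiffOn ℝ 1 S J ∧ ContDiffOn ℝ 1 N J ∧
      (∀ r ∈ J, deriv S r ≠ 0 ∧ N r ≠ 0) ∧ ∀ x ∈ domain I J D, s x = S (x 1) ∧
        n x = 1 / (vol φ ω₁ ω₂ Q x * N (x 1)) ∧ ε x = ρ x / n x - 1 ∧
        Θ x * deriv S (x 1) =
          deriv N (x 1) * enth v φ ω₁ ω₂ Q x + N (x 1) * lam v φ ω₂ (x 0) * deriv Q (x 1) := by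
  have h := hT.isGeometry
  have hU := h.isOpen_domain
  have hI' := hT.I_connected.isPreconnected
  -- `M` will turn out to be the function `N`; so far it may depend on all four coordinates.
  let M : Pt → ℝ := fun x => 1 / (n x * vol φ ω₁ ω₂ Q x)
  have hV := fun x (hx : x ∈ domain I J D) => hT.vol_ne hn hx
  have hM0 : ∀ x ∈ domain I J D, M x ≠ 0 := fun x hx =>
    one_div_ne_zero (mul_ne_zero (hs.n_ne_zero x hx) (hV x hx))
  have hMc : ContDiffOn ℝ 1 M (domain I J D) :=
    contDiffOn_const.div (hs.n_contDiff.mul (hT.contDiffOn_vol hn)) fun x hx =>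
      mul_ne_zero (hs.n_ne_zero x hx) (hV x hx)
  have hMd : ∀ x ∈ domain I J D, DifferentiableAt ℝ M x := fun x hx =>
    (hMc.contDiffAt (hU.mem_nhds hx)).differentiableAt (by simp)
  have hsd : ∀ x ∈ domain I J D, DifferentiableAt ℝ s x := fun x hx =>
    (hs.s_contDiff.contDiffAt (hU.mem_nhds hx)).differentiableAt (by simp)
  have hnM : ∀ x ∈ domain I J D, n x = 1 / (vol φ ω₁ ω₂ Q x * M x) := fun x hx => by
    have h1 := hs.n_ne_zero x hx
    have h2 := hV x hx
    simp only [M]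
    field_simp
  have hε : ∀ x ∈ domain I J D, ε x = ρ x / n x - 1 := fun x hx => by
    have h1 := hs.n_ne_zero x hx
    rw [hs.energy_decomposition x hx]
    field_simp
    ring
  have hlaws := fun x hx => hT.laws hn hM0 hnM hε (x := x) hx (hMd x hx).hasFDerivAt
  have hMt : ∀ x ∈ domain I J D, pd 0 M x = 0 := fun x hx => by
    have e := (hlaws x hx).1
    rw [hs.matter_conservation x hx] at e
    have h1 := (h.sqrt_pos hx.1).ne'
    have h2 := mul_ne_zero (hV x hx) (pow_ne_zero 2 (hM0 x hx))
    have e' := (div_eq_zero_iff.1 (neg_eq_zero.1 e.symm)).resolve_right h2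
    exact (mul_eq_zero.1 e').resolve_left h1
  have hfirst : ∀ x ∈ domain I J D, ∀ i, Θ x * pd i s x = enth v φ ω₁ ω₂ Q x * pd i M x
      + M x * lam v φ ω₂ (x 0) * deriv Q (x 1) * (Pi.single i 1 : Pt) 1 := fun x hx i => by
    have e := (hs.first_law x hx).trans (hlaws x hx).2
    simpa [pd] using congrArg (fun l : Pt →L[ℝ] ℝ => l (Pi.single i 1)) e
  have hMu : ∀ x ∈ domain I J D, ∀ t ∈ I, M (Function.update x 0 t) = M x := fun x hx t ht =>
    eq_of_pd_zero hT.I_open hI' hMd hMt hx ht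
  have hMpd : ∀ x ∈ domain I J D, ∀ t ∈ I, ∀ i, i ≠ 0 →
      pd i M (Function.update x 0 t) = pd i M x := fun x hx t ht i hi =>
    pd_update_time hU hMd hMu hx ht hi
  have hind : ∀ x ∈ domain I J D, ∀ A B : ℝ,
      (∀ᶠ t in 𝓝 (x 0), A * lam v φ ω₁ t + B * lam v φ ω₂ t = 0) → A = 0 ∧ B = 0 :=
    fun x hx A B hAB => h.eq_zero_of_lam_eventually hn.ω₁_smooth hn.ω₂_smooth hn.ω₁_solves
      hn.ω₂_solves hx.1 (h.wronskian_ne_zero hn.ω₁_smooth hn.ω₂_smooth hn.ω₁_solves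
        hn.ω₂_solves hr.independent hx.1) (hr.p_ne _ hx.1) (hr.φ_ne _ hx.1) hAB
  have hrad : ∀ x ∈ domain I J D, ∀ t ∈ I,
      Θ (Function.update x 0 t) * pd 1 s (Function.update x 0 t) =
        pd 1 M x * lam v φ ω₁ t + (Q (x 1) * pd 1 M x + M x * deriv Q (x 1)) * lam v φ ω₂ t :=
    fun x hx t ht => by
      rw [hfirst _ (update_mem_domain hx ht), hMpd x hx t ht 1 (by decide), hMu x hx t ht,
        enth_update]
      simp [Function.update]
      ring
  have hIev : ∀ x ∈ domain I J D, ∀ᶠ t in 𝓝 (x 0), t ∈ I := fun x hx => hT.I_open.mem_nhds hx.1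
  -- If `Θ ∂_r s` vanished for nearby times, both coefficients of the radial equation would vanish
  -- by independence of the `λ_i`, forcing `M Q' = 0`.
  have hnot : ∀ x ∈ domain I J D, ¬ ∀ᶠ t in 𝓝 (x 0),
      Θ (Function.update x 0 t) * pd 1 s (Function.update x 0 t) = 0 := fun x hx hev => by
    have := hind x hx (pd 1 M x) (Q (x 1) * pd 1 M x + M x * deriv Q (x 1)) (by
      filter_upwards [hev, hIev x hx] with t h1 h2
      rw [← hrad x hx t h2, h1])
    have h2 : M x * deriv Q (x 1) = 0 := by linear_combination this.2 - Q (x 1) * this.1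
    exact (mul_ne_zero (hM0 x hx) (hr.Q_ne _ hx.2.1)) h2
  -- The time component of the first law is `Θ ∂_t s = 0`. Where `∂_t s ≠ 0`, continuity keeps it
  -- nonzero for nearby times, so `Θ` vanishes there, which `hnot` excludes. No regularity of `Θ` is
  -- needed.
  have hst : ∀ x ∈ domain I J D, pd 0 s x = 0 := fun x hx => by
    by_contra hne
    have hc : ContinuousAt (fun t => pd 0 s (Function.update x 0 t)) (x 0) := by
      have h1 : ContinuousOn (fun y => pd 0 s y) (domain I J D) :=
        (hs.s_contDiff.continuousOn_fderiv_of_isOpen hU le_rfl).clm_apply continuousOn_const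
      have h2 : ContinuousAt (fun y => pd 0 s y) (Function.update x 0 (x 0)) := by
        simpa using h1.continuousAt (hU.mem_nhds hx)
      exact ContinuousAt.comp (f := fun t => Function.update x 0 t) h2
        (hasDerivAt_update x 0 (x 0)).continuousAt
    have hev := hc.eventually_ne (y := 0) (by simpa using hne)
    refine hnot x hx ?_
    filter_upwards [hev, hIev x hx] with t h1 h2
    have hy := update_mem_domain hx h2
    have := hfirst _ hy 0
    rw [hMt _ hy] at this
    have hΘ : Θ (Function.update x 0 t) = 0 := by
      refine (mul_eq_zero.1 (?_ : _ * pd 0 s (Function.update x 0 t) = 0)).resolve_right h1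
      rw [this]
      simp
    rw [hΘ, zero_mul]
  have hsu : ∀ x ∈ domain I J D, ∀ t ∈ I, s (Function.update x 0 t) = s x := fun x hx t ht =>
    eq_of_pd_zero hT.I_open hI' hsd hst hx ht
  have hspd : ∀ x ∈ domain I J D, ∀ t ∈ I, ∀ i, i ≠ 0 →
      pd i s (Function.update x 0 t) = pd i s x := fun x hx t ht i hi =>
    pd_update_time hU hsd hsu hx ht hi
  have hsr : ∀ x ∈ domain I J D, pd 1 s x ≠ 0 := fun x hx h0 => hnot x hx (by
    filter_upwards [hIev x hx] with t ht
    rw [hspd x hx t ht 1 (by decide), h0, mul_zero])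
  -- Eliminating `Θ` between an angular component and the radial one leaves a relation between the
  -- `λ_i` with coefficients constant in time, so both coefficients vanish.
  have hang : ∀ x ∈ domain I J D, ∀ i, i ≠ 0 → i ≠ 1 → pd i s x = 0 ∧ pd i M x = 0 := by
    intro x hx i hi0 hi1
    have := hind x hx (pd i s x * pd 1 M x - pd 1 s x * pd i M x)
      (pd i s x * (Q (x 1) * pd 1 M x + M x * deriv Q (x 1)) - pd 1 s x * (Q (x 1) * pd i M x)) (by
        filter_upwards [hIev x hx] with t ht
        have e1 := hrad x hx t ht
        have e2 := hfirst _ (update_mem_domain hx ht) i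
        rw [hMpd x hx t ht i hi0, hspd x hx t ht i hi0, enth_update,
          Pi.single_eq_of_ne hi1.symm] at e2
        rw [hspd x hx t ht 1 (by decide)] at e1
        linear_combination pd 1 s x * e2 - pd i s x * e1)
    have h1 : pd i s x * (M x * deriv Q (x 1)) = 0 := by
      linear_combination this.2 - Q (x 1) * this.1
    have h2 := (mul_eq_zero.1 h1).resolve_right (mul_ne_zero (hM0 x hx) (hr.Q_ne _ hx.2.1))
    refine ⟨h2, (mul_eq_zero.1 (?_ : pd 1 s x * pd i M x = 0)).resolve_left (hsr x hx)⟩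
    linear_combination -this.1 + pd 1 M x * h2
  obtain ⟨t₀, ht₀⟩ := hT.I_connected.nonempty
  obtain ⟨z₀, hz₀⟩ := hT.D_connected.nonempty
  have hcurve : ∀ r ∈ J, (![t₀, r, z₀.1, z₀.2] : Pt) ∈ domain I J D := fun r hr => ⟨ht₀, hr, hz₀⟩
  have hcurve_c : ContDiff ℝ 1 (fun r : ℝ => (![t₀, r, z₀.1, z₀.2] : Pt)) := by
    rw [contDiff_pi]
    intro i
    fin_cases i
    · exact contDiff_const
    · exact contDiff_id
    · exact contDiff_const
    · exact contDiff_const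
  have hradial : ∀ f : Pt → ℝ, (∀ x ∈ domain I J D, DifferentiableAt ℝ f x) →
      (∀ x ∈ domain I J D, f x = f ![t₀, x 1, z₀.1, z₀.2]) → ∀ x ∈ domain I J D,
      deriv (fun r => f ![t₀, r, z₀.1, z₀.2]) (x 1) = pd 1 f x := by
    intro f hfd hf x hx
    refine (HasDerivAt.congr_of_eventuallyEq (hasDerivAt_comp_update 1 (hfd x hx)) ?_).deriv
    filter_upwards [hT.J_open.mem_nhds hx.2.1] with r hr
    have hy : Function.update x 1 r ∈ domain I J D := by
      refine ⟨?_, ?_, ?_⟩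
      · simpa [Function.update] using hx.1
      · simpa using hr
      · simpa [Function.update] using hx.2.2
    have := hf _ hy
    rw [Function.update_self] at this
    exact this.symm
  have hS : ∀ x ∈ domain I J D, s x = s ![t₀, x 1, z₀.1, z₀.2] := fun x hx =>
    eq_radial hT.D_open hT.D_connected.isPreconnected hsd hsu
      (fun x hx => (hang x hx 2 (by decide) (by decide)).1)
      (fun x hx => (hang x hx 3 (by decide) (by decide)).1) ht₀ hz₀ hx
  have hN : ∀ x ∈ domain I J D, M x = M ![t₀, x 1, z₀.1, z₀.2] := fun x hx =>
    eq_radial hT.D_open hT.D_connected.isPreconnected hMd hMu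
      (fun x hx => (hang x hx 2 (by decide) (by decide)).2)
      (fun x hx => (hang x hx 3 (by decide) (by decide)).2) ht₀ hz₀ hx
  refine ⟨fun r => s ![t₀, r, z₀.1, z₀.2], fun r => M ![t₀, r, z₀.1, z₀.2],
    hs.s_contDiff.comp hcurve_c.contDiffOn hcurve, hMc.comp hcurve_c.contDiffOn hcurve,
    fun r hr => ⟨?_, hM0 _ (hcurve r hr)⟩, fun x hx => ⟨hS x hx, ?_, hε x hx, ?_⟩⟩
  · have := hradial s hsd hS _ (hcurve r hr)
    exact this.trans_ne (hsr _ (hcurve r hr))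
  · rw [hnM x hx, hN x hx]
  · rw [hradial s hsd hS x hx, hradial M hMd hN x hx, hfirst x hx 1, hN x hx]
    simp
    ring

end Schemes

end TModel

namespace TModel

open Set Filter Topology

/-! ### State functions, speed of sound and the general scheme. -/

section Indicatrix

variable {k : ℝ} {I J : Set ℝ} {D : Set (ℝ × ℝ)} {v φ : ℝ → ℝ} {ω : ℝ → ℝ → ℝ} {ρ p : Pt → ℝ}
  {ω₁ ω₂ a Q w : ℝ → ℝ} {n ε s Θ : Pt → ℝ}

/-- With `W = ω₁ + ω₂ Q`, the state term of `w` is `φ̇ / W` times the Wronskian `w Ẇ - ẇ W`. It is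
linear in `w` and vanishes for `W`; solving that relation for `Q` gives `IsTModel.Q_eq`. -/
lemma IsTModel.stateTerm_eq (hT : IsTModel k I J D v φ ω ρ p)
    (hn : IsNormalForm k I J v φ ω ω₁ ω₂ a Q) (hw : ContDiffOn ℝ (⊤ : ℕ∞) w I) {x : Pt}
    (hx : x ∈ domain I J D) :
    stateTerm k v φ w (x 0) (ρ x) (p x) = dot v φ (x 0) / (ω₁ (x 0) + ω₂ (x 0) * Q (x 1))
      * (w (x 0) * (dot v ω₁ (x 0) + dot v ω₂ (x 0) * Q (x 1))
        - dot v w (x 0) * (ω₁ (x 0) + ω₂ (x 0) * Q (x 1))) := by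
  have h := hT.isGeometry
  have h1 := (h.φ_pos _ hx.1).ne'
  have h2 := (hn.pos hT.ω_pos hx.1 hx.2.1).ne'
  rw [stateTerm, h.dot_mul (h.smooth_dot h.φ_smooth) hw hx.1,
    (h.fieldEq hT.perfectFluid hx).2.1, hT.p_eq hx, hn.dot_div h.toIsClock hx.1 hx.2.1]
  simp only [pressure, β, σ, ξ]
  generalize ω₁ (x 0) + ω₂ (x 0) * Q (x 1) = W at h2 ⊢
  generalize dot v ω₁ (x 0) + dot v ω₂ (x 0) * Q (x 1) = W'
  field_simp
  ring

lemma IsTModel.Q_eq (hT : IsTModel k I J D v φ ω ρ p)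
    (hn : IsNormalForm k I J v φ ω ω₁ ω₂ a Q) (hr : IsRegular k I J v φ ω₁ ω₂ Q) {x : Pt}
    (hx : x ∈ domain I J D) :
    stateTerm k v φ ω₂ (x 0) (ρ x) (p x) ≠ 0 ∧
      Q (x 1) = -stateTerm k v φ ω₁ (x 0) (ρ x) (p x) / stateTerm k v φ ω₂ (x 0) (ρ x) (p x) := by
  have h := hT.isGeometry
  have h2 := (hn.pos hT.ω_pos hx.1 hx.2.1).ne'
  have hW := h.wronskian_ne_zero hn.ω₁_smooth hn.ω₂_smooth hn.ω₁_solves hn.ω₂_solves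
    hr.independent hx.1
  have e2 : stateTerm k v φ ω₂ (x 0) (ρ x) (p x) =
      dot v φ (x 0) / (ω₁ (x 0) + ω₂ (x 0) * Q (x 1))
        * (dot v ω₁ (x 0) * ω₂ (x 0) - ω₁ (x 0) * dot v ω₂ (x 0)) := by
    rw [hT.stateTerm_eq hn hn.ω₂_smooth hx]
    ring
  have hne : stateTerm k v φ ω₂ (x 0) (ρ x) (p x) ≠ 0 := by
    rw [e2]
    exact mul_ne_zero (div_ne_zero (hr.φ_ne _ hx.1) h2) hW
  refine ⟨hne, ?_⟩
  rw [eq_div_iff hne, e2, hT.stateTerm_eq hn hn.ω₁_smooth hx]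
  ring

lemma IsTModel.time_eq (hT : IsTModel k I J D v φ ω ρ p) (hr : IsRegular k I J v φ ω₁ ω₂ Q)
    {x y : Pt} (hx : x ∈ domain I J D) (hy : y ∈ domain I J D) (hxy : p x = p y) : x 0 = y 0 := by
  have h := hT.isGeometry
  rw [hT.p_eq hx, hT.p_eq hy] at hxy
  refine injOn_of_deriv_ne_zero (Q := pressure k v φ) h.isPreconnected
    (fun t ht => (h.hasDerivAt h.pressure_smooth ht).differentiableAt) (fun t ht h0 => ?_)
    hx.1 hy.1 hxy
  exact hr.p_ne t ht (by rw [dot, h0, mul_zero])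

/-- Since `√β = |φ̇/φ|`, the sign in the definition removes the absolute value. -/
lemma IsGeometry.coeffA_eq (h : IsGeometry k I J D v φ ω) {t : ℝ} (ht : t ∈ I)
    (hφ : dot v φ t ≠ 0) :
    coeffA k v φ t = -(1 / (dot v φ t / φ t * dot v (pressure k v φ) t)) := by
  have h0 : dot v φ t / φ t ≠ 0 := div_ne_zero hφ (h.φ_pos t ht).ne'
  have hβ : √(β v φ t) = |dot v φ t / φ t| := by rw [β, ← div_pow, Real.sqrt_sq_eq_abs]
  rw [coeffA, hβ]
  rcases h0.lt_or_gt with hneg | hpos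
  · rw [Real.sign_of_neg hneg, abs_of_neg hneg]
    ring
  · rw [Real.sign_of_pos hpos, abs_of_pos hpos]
    ring

lemma IsTModel.along_eq (hT : IsTModel k I J D v φ ω ρ p)
    (hn : IsNormalForm k I J v φ ω ω₁ ω₂ a Q) (hr : IsRegular k I J v φ ω₁ ω₂ Q) {x : Pt}
    (hx : x ∈ domain I J D) :
    along (velocity v) ρ x = along (velocity v) p x *
      (coeffA k v φ (x 0) * ρ x ^ 2 + coeffB k v φ (x 0) * ρ x + coeffC k v φ (x 0)) := by
  have h := hT.isGeometry
  have h1 := (h.φ_pos _ hx.1).ne'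
  have h2 := (h.ω_pos _ hx.1 _ hx.2.1).ne'
  have hφ := hr.φ_ne _ hx.1
  have hp := hr.p_ne _ hx.1
  -- The formula for `ρ` is solved for `ω̇/ω`, which makes the expansion affine in `ρ`.
  have hθ : expansion (metric k v φ ω) (velocity v) x =
      (ρ x + q k v φ (x 0)) / (dot v φ (x 0) / φ (x 0)) := by
    rw [h.expansion_eq hx, (h.fieldEq hT.perfectFluid hx).2.1, q, β]
    field_simp
    ring
  rw [along_velocity, along_velocity, (hT.pd_ρ hn hx).2.2, (hT.pd_p hx).2.2, coeffB, coeffC, hθ,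
    h.coeffA_eq hx.1 hφ, hT.p_eq hx]
  field_simp
  ring

/-- As `s` is a function of `r` with nonzero derivative, the isentropic directions are those with no
`r` component. On them `dp` and `dρ` see only the time component, so their ratio is that of the
derivatives along `u`. -/
lemma IsTModel.isPartialAtConst (hT : IsTModel k I J D v φ ω ρ p)
    (hn : IsNormalForm k I J v φ ω ω₁ ω₂ a Q) (hr : IsRegular k I J v φ ω₁ ω₂ Q) {x : Pt}
    (hx : x ∈ domain I J D) (hρ : along (velocity v) ρ x ≠ 0)
    (hs : IsThermodynamicScheme (domain I J D) (metric k v φ ω) (velocity v) ρ p n ε s Θ) :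
    IsPartialAtConst p ρ s x (along (velocity v) p x / along (velocity v) ρ x) := by
  obtain ⟨S, N, hS, -, hSN, hx'⟩ := hT.scheme_radial hn hr hs
  have hsd : HasFDerivAt s (deriv S (x 1) • dx 1) x :=
    (hasFDerivAt_comp_coord ((hS.contDiffAt (hT.J_open.mem_nhds hx.2.1)).differentiableAt
      (by simp)).hasDerivAt).congr_of_eventuallyEq (by
        filter_upwards [hT.isGeometry.isOpen_domain.mem_nhds hx] with y hy using (hx' y hy).1)
  have hsv := (hT.isGeometry.sqrt_pos hx.1).ne'
  rw [along_velocity] at hρ ⊢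
  rw [along_velocity]
  have hρ0 := right_ne_zero_of_mul hρ
  have hexp : ∀ (f : Pt → ℝ) (X : Pt), fderiv ℝ f x X = ∑ i, X i * pd i f x := fun f X => by
    have hX : X = ∑ i, X i • (Pi.single i 1 : Pt) := by
      funext j
      simp [Finset.sum_apply, Pi.single_apply]
    conv_lhs => rw [hX]
    simp [pd]
  rw [IsPartialAtConst, hsd.fderiv]
  refine ⟨⟨Pi.single 0 1, by simp, hρ0⟩, fun X hX => ?_⟩
  have hX1 : X 1 = 0 := by simpa [(hSN _ hx.2.1).1] using hX
  rw [hexp p, hexp ρ, Fin.sum_univ_four, Fin.sum_univ_four, hX1,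
    (hT.pd_p hx).2.1 2 (by decide), (hT.pd_p hx).2.1 3 (by decide),
    (hT.pd_ρ hn hx).2.1 2 (by decide) (by decide), (hT.pd_ρ hn hx).2.1 3 (by decide) (by decide)]
  field_simp
  ring

/-- The thermodynamic schemes of a regular T-model. -/
lemma IsTModel.isThermodynamicScheme_iff (hT : IsTModel k I J D v φ ω ρ p)
    (hn : IsNormalForm k I J v φ ω ω₁ ω₂ a Q) (hr : IsRegular k I J v φ ω₁ ω₂ Q) :
    IsThermodynamicScheme (domain I J D) (metric k v φ ω) (velocity v) ρ p n ε s Θ ↔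
      ∃ S N : ℝ → ℝ, ContDiffOn ℝ 1 S (Q '' J) ∧ ContDiffOn ℝ 1 N (Q '' J) ∧
        (∀ c ∈ Q '' J, deriv S c ≠ 0 ∧ N c ≠ 0) ∧ ∀ x ∈ domain I J D,
          s x = S (Q (x 1)) ∧
          n x = 1 / (φ (x 0) * (ω₁ (x 0) + ω₂ (x 0) * Q (x 1)) * N (Q (x 1))) ∧
          ε x = ρ x / n x - 1 ∧
          Θ x = deriv N (Q (x 1)) / deriv S (Q (x 1)) * lam v φ ω₁ (x 0)
            + (Q (x 1) * deriv N (Q (x 1)) + N (Q (x 1))) / deriv S (Q (x 1))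
              * lam v φ ω₂ (x 0) := by
  obtain ⟨hQo, R, hR, hRQ⟩ := exists_inverse hT.J_open hT.J_connected.isPreconnected hn.Q_smooth
    hr.Q_ne
  have hQ1 : ContDiffOn ℝ 1 Q J := hn.Q_smooth.of_le (by exact_mod_cast le_top)
  have hQd : ∀ r ∈ J, HasDerivAt Q (deriv Q r) r := fun r hr =>
    hasDerivAt_of_smooth hT.J_open hn.Q_smooth hr
  -- Passing between `r` and `c = Q(r)` multiplies both `S'` and `N'` by `Q'`, a factor common to
  -- all terms of the temperature equation.
  have hchain : ∀ F G : ℝ → ℝ, ContDiffOn ℝ 1 F (Q '' J) → (∀ r ∈ J, G r = F (Q r)) →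
      ∀ r ∈ J, deriv G r = deriv F (Q r) * deriv Q r := by
    intro F G hF hFG r hr
    have hFd := ((hF.contDiffAt (hQo.mem_nhds (mem_image_of_mem Q hr))).differentiableAt
      (by simp)).hasDerivAt
    refine ((hFd.comp r (hQd r hr)).congr_of_eventuallyEq ?_).deriv
    filter_upwards [hT.J_open.mem_nhds hr] with y hy using hFG y hy
  constructor
  · intro hs
    obtain ⟨S, N, hS, hN, hSN, hx⟩ := hT.scheme_radial hn hr hs
    have hmaps : MapsTo R (Q '' J) J := by
      rintro _ ⟨r, hr, rfl⟩
      rwa [hRQ r hr]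
    have hS' : ContDiffOn ℝ 1 (fun c => S (R c)) (Q '' J) := hS.comp hR hmaps
    have hN' : ContDiffOn ℝ 1 (fun c => N (R c)) (Q '' J) := hN.comp hR hmaps
    have dS := hchain _ S hS' fun r hr => by simp only [hRQ r hr]
    have dN := hchain _ N hN' fun r hr => by simp only [hRQ r hr]
    refine ⟨_, _, hS', hN', ?_, fun x hxU => ?_⟩
    · rintro _ ⟨r, hr, rfl⟩
      refine ⟨fun h0 => (hSN r hr).1 ?_, ?_⟩
      · rw [dS r hr, h0, zero_mul]
      · simpa only [hRQ r hr] using (hSN r hr).2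
    · obtain ⟨e1, e2, e3, e4⟩ := hx x hxU
      have hJ := hxU.2.1
      have hQ0 := hr.Q_ne _ hJ
      have hS0 := (hSN _ hJ).1
      rw [dS _ hJ, dN _ hJ, enth] at e4
      rw [dS _ hJ] at hS0
      have hS1 := left_ne_zero_of_mul hS0
      refine ⟨by simpa only [hRQ _ hJ] using e1, by simpa only [hRQ _ hJ, vol] using e2, e3, ?_⟩
      simp only [hRQ _ hJ]
      generalize deriv (fun c => S (R c)) (Q (x 1)) = S' at *
      generalize deriv (fun c => N (R c)) (Q (x 1)) = N' at *
      field_simp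
      refine mul_left_cancel₀ hQ0 ?_
      linear_combination e4
  · rintro ⟨S, N, hS, hN, hSN, hx⟩
    have hmaps : MapsTo Q J (Q '' J) := mapsTo_image Q J
    have dS := hchain S (fun r => S (Q r)) hS fun _ _ => rfl
    have dN := hchain N (fun r => N (Q r)) hN fun _ _ => rfl
    refine hT.isThermodynamicScheme hn (S := fun r => S (Q r)) (N := fun r => N (Q r))
      (hS.comp hQ1 hmaps) (hN.comp hQ1 hmaps) (fun r hr => (hSN _ (mem_image_of_mem Q hr)).2)
      (fun x hxU => (hx x hxU).1) (fun x hxU => (hx x hxU).2.1) (fun x hxU => (hx x hxU).2.2.1)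
      fun x hxU => ?_
    have hS0 := (hSN _ (mem_image_of_mem Q hxU.2.1)).1
    rw [dS _ hxU.2.1, dN _ hxU.2.1, (hx x hxU).2.2.2, enth]
    field_simp
    ring

end Indicatrix

end TModel

theorem mainTheorem4 (k : ℝ) (hk : k = 0 ∨ k = 1 ∨ k = -1) (I J : Set ℝ) (D : Set (ℝ × ℝ))
    (v φ : ℝ → ℝ) (ω : ℝ → ℝ → ℝ) (ρ p : TModel.Pt → ℝ)
    (hT : TModel.IsTModel k I J D v φ ω ρ p) :
    -- the fluid is geodesic; its expansion, pressure and energy density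
    (∀ x ∈ TModel.domain I J D,
      TModel.acceleration (TModel.metric k v φ ω) (TModel.velocity v) x = 0 ∧
      TModel.expansion (TModel.metric k v φ ω) (TModel.velocity v) x =
        TModel.dot v φ (x 0) / φ (x 0)
          + TModel.dot v (fun t => ω t (x 1)) (x 0) / ω (x 0) (x 1) ∧
      p x = TModel.pressure k v φ (x 0) ∧
      ρ x = 1 / 4 * TModel.β v φ (x 0) + TModel.ξ k φ (x 0)
        + TModel.dot v φ (x 0) / φ (x 0)
          * (TModel.dot v (fun t => ω t (x 1)) (x 0) / ω (x 0) (x 1))) ∧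
    -- local thermal equilibrium
    TModel.EvolvesInLTE (TModel.domain I J D) (TModel.metric k v φ ω) (TModel.velocity v) ρ p ∧
    -- the normal form of the metric function `ω`
    (∃ ω₁ ω₂ a Q : ℝ → ℝ, TModel.IsNormalForm k I J v φ ω ω₁ ω₂ a Q) ∧
    ∀ ω₁ ω₂ a Q : ℝ → ℝ, TModel.IsNormalForm k I J v φ ω ω₁ ω₂ a Q →
      TModel.IsRegular k I J v φ ω₁ ω₂ Q →
      -- time and `Q` are functions of `(ρ, p)`, the latter explicitly
      (∀ x ∈ TModel.domain I J D, ∀ y ∈ TModel.domain I J D, p x = p y → x 0 = y 0) ∧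
      (∀ x ∈ TModel.domain I J D,
        TModel.stateTerm k v φ ω₂ (x 0) (ρ x) (p x) ≠ 0 ∧
        Q (x 1) = -TModel.stateTerm k v φ ω₁ (x 0) (ρ x) (p x)
          / TModel.stateTerm k v φ ω₂ (x 0) (ρ x) (p x)) ∧
      -- the indicatrix function, that is, the square of the speed of sound
      (∃ A B C : ℝ → ℝ,
        (∀ x ∈ TModel.domain I J D,
          A (p x) = TModel.coeffA k v φ (x 0) ∧
          B (p x) = TModel.coeffB k v φ (x 0) ∧
          C (p x) = TModel.coeffC k v φ (x 0)) ∧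
        ∀ x ∈ TModel.domain I J D,
          TModel.along (TModel.velocity v) ρ x = TModel.along (TModel.velocity v) p x
            * (A (p x) * ρ x ^ 2 + B (p x) * ρ x + C (p x)) ∧
          (TModel.along (TModel.velocity v) ρ x ≠ 0 →
            A (p x) * ρ x ^ 2 + B (p x) * ρ x + C (p x) ≠ 0 ∧
            TModel.along (TModel.velocity v) p x / TModel.along (TModel.velocity v) ρ x =
              1 / (A (p x) * ρ x ^ 2 + B (p x) * ρ x + C (p x)) ∧
            ∀ n ε s Θ : TModel.Pt → ℝ,
              TModel.IsThermodynamicScheme (TModel.domain I J D) (TModel.metric k v φ ω)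
                (TModel.velocity v) ρ p n ε s Θ →
              TModel.IsPartialAtConst p ρ s x
                (1 / (A (p x) * ρ x ^ 2 + B (p x) * ρ x + C (p x))))) ∧
      -- all the thermodynamic schemes
      ∀ n ε s Θ : TModel.Pt → ℝ,
        TModel.IsThermodynamicScheme (TModel.domain I J D) (TModel.metric k v φ ω)
          (TModel.velocity v) ρ p n ε s Θ ↔
        ∃ S N : ℝ → ℝ,
          ContDiffOn ℝ 1 S (Q '' J) ∧ ContDiffOn ℝ 1 N (Q '' J) ∧
          (∀ c ∈ Q '' J, deriv S c ≠ 0 ∧ N c ≠ 0) ∧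
          ∀ x ∈ TModel.domain I J D,
            s x = S (Q (x 1)) ∧
            n x = 1 / (φ (x 0) * (ω₁ (x 0) + ω₂ (x 0) * Q (x 1)) * N (Q (x 1))) ∧
            ε x = ρ x / n x - 1 ∧
            Θ x = deriv N (Q (x 1)) / deriv S (Q (x 1)) * TModel.lam v φ ω₁ (x 0)
              + (Q (x 1) * deriv N (Q (x 1)) + N (Q (x 1))) / deriv S (Q (x 1))
                * TModel.lam v φ ω₂ (x 0) := by
  have h := hT.isGeometry
  refine ⟨fun x hx => ⟨h.acceleration_eq_zero hx, h.expansion_eq hx, hT.p_eq hx,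
    (h.fieldEq hT.perfectFluid hx).2.1⟩, hT.evolvesInLTE, hT.exists_normalForm, ?_⟩
  intro ω₁ ω₂ a Q hn hr
  refine ⟨fun x hx y hy hxy => hT.time_eq hr hx hy hxy, fun x hx => hT.Q_eq hn hr hx, ?_,
    fun n ε s Θ => hT.isThermodynamicScheme_iff hn hr⟩
  -- Since `p` determines the time, any function of time factors through `p`; outside the range of
  -- `p` the value `0` is arbitrary.
  have hfun : ∀ f : ℝ → ℝ, ∃ F : ℝ → ℝ, ∀ x ∈ TModel.domain I J D, F (p x) = f (x 0) := by
    intro f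
    classical
    refine ⟨fun P => if hP : ∃ x ∈ TModel.domain I J D, p x = P then f (hP.choose 0) else 0,
      fun x hx => ?_⟩
    have hP : ∃ y ∈ TModel.domain I J D, p y = p x := ⟨x, hx, rfl⟩
    exact (dif_pos hP).trans (by rw [hT.time_eq hr hP.choose_spec.1 hx hP.choose_spec.2])
  obtain ⟨A, hA⟩ := hfun (TModel.coeffA k v φ)
  obtain ⟨B, hB⟩ := hfun (TModel.coeffB k v φ)
  obtain ⟨C, hC⟩ := hfun (TModel.coeffC k v φ)
  refine ⟨A, B, C, fun x hx => ⟨hA x hx, hB x hx, hC x hx⟩, fun x hx => ?_⟩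
  have key := hT.along_eq hn hr hx
  rw [← hA x hx, ← hB x hx, ← hC x hx] at key
  refine ⟨key, fun hρ => ?_⟩
  have hχ : A (p x) * ρ x ^ 2 + B (p x) * ρ x + C (p x) ≠ 0 := fun h0 => hρ (by
    rw [key, h0, mul_zero])
  have hp : TModel.along (TModel.velocity v) p x ≠ 0 := fun h0 => hρ (by
    rw [key, h0, zero_mul])
  have hc : TModel.along (TModel.velocity v) p x / TModel.along (TModel.velocity v) ρ x =
      1 / (A (p x) * ρ x ^ 2 + B (p x) * ρ x + C (p x)) := by
    rw [key]
    field_simp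
  exact ⟨hχ, hc, fun n ε s Θ hs => hc ▸ hT.isPartialAtConst hn hr hx hρ hs⟩
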